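/- Graphs are finite and simple. A graph $G$ contains a graph $H$ as an immersion if there are an injective map $\phi\colon V(H)\to V(G)$ and, for every edge $uv\in E(H)$, a path $P_{uv}$ in $G$ with endpoints $\phi(u)$ and $\phi(v)$, such that the paths $P_{uv}$, $uv\in E(H)$, are pairwise edge-disjoint. Define $f(3)=f(4)=2.25$ and $f(\alpha)=2.25+\sum_{i=6}^{\alpha+1}\frac{1}{2i}$ for integers $\alpha\ge 5$. Theorem. Let $G$ be a graph on $n$ vertices with independence number $\alpha$. If $\alpha\ge 3$, then $G$ contains an immersion of a clique on at least $\left\lfloor \frac{n}{2.25\,\alpha-f(\alpha)}\right\rfloor-1$ vertices. Moreover, if $1\le\alpha\le 10$, then $G$ contains an immersion of a clique on $\left\lfloor \frac{n}{2\alpha}\right\rfloor-1$ vertices (nothing is claimed when this number is negative). -/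

import Mathlib

/-- `G` contains `H` as an immersion: there are an injective map `φ` from the vertices of `H` to
those of `G` (its values are the branch vertices) and, for every edge `uv` of `H`, a path
`P u v` of `G` with endpoints `φ u` and `φ v`, such that the paths of distinct edges of `H` have
no edge in common. An edge is undirected, so there is one path per edge: `P v u` is `P u v` read
backwards. -/
def ContainsImmersion {V W : Type*} (G : SimpleGraph V) (H : SimpleGraph W) : Prop :=
  ∃ (φ : W ↪ V) (P : ∀ u v : W, H.Adj u v → G.Path (φ u) (φ v)),
    (∀ (u v : W) (h : H.Adj u v), P v u h.symm = (P u v h).reverse) ∧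
    ∀ (u v u' v' : W) (h : H.Adj u v) (h' : H.Adj u' v'), s(u, v) ≠ s(u', v') →
      List.Disjoint (P u v h : G.Walk (φ u) (φ v)).edges
        (P u' v' h' : G.Walk (φ u') (φ v')).edges

/-- The function with `f 3 = f 4 = 9/4` and `f α = 9/4 + ∑_{i=6}^{α+1} 1/(2i)` for `α ≥ 5`.
It is only used for `α ≥ 3`. -/
def immersionF (α : ℕ) : ℚ :=
  if α ≤ 4 then 9 / 4 else 9 / 4 + ∑ i ∈ Finset.Icc 6 (α + 1), 1 / (2 * (i : ℚ))

/-! Both bounds follow from one: if the independence number is at most a ≥ 2 and there are at least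
(2a − 3/2)t vertices, then K_t is immersed; for a = 1, t vertices suffice. The argument takes a
minimal counterexample, deletes a small set, and extends the clique immersion found in the rest.

For a ≥ 3 the deleted set is an independent set I of size a, and some b ∈ I becomes the new branch
vertex. Every old branch vertex has a neighbour in I, since I is maximum. From there it must reach b
through I, with each vertex outside I serving only one route; this makes the routes edge-disjoint.
By Menger, such routes exist if every nonempty Y ⊆ I avoiding b is joined to I \ Y by enough outside
vertices. The vertices with no neighbour in Y have smaller independence number and no immersed
clique of the target size, so by induction they are few; likewise for I \ Y. Superadditivity of the
factor (`cliqueFactor_add_le`) leaves enough vertices that meet both parts.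

For a = 2 superadditivity fails. A nonadjacent pair with t − 1 common neighbours can still play the
role of I. If no such pair exists and there is no clique of size t, counting shows that the
complement contains a 5-cycle, hence that G has an induced C₅. Deleting it costs five vertices and
two branch vertices, exactly the ratio 5/2. Two consecutive vertices of the hole are then added: an
old branch vertex not adjacent to one of them reaches it by a detour through another hole vertex and
a private helper, and Hall's theorem supplies the helpers. -/

/-! ### Arc-disjoint routes to a root -/

/-- `l` is a list of consecutive arcs leading from `x` to `r`. -/
def IsRoute {N : Type*} (r : N) : N → List (N × N) → Prop
  | x, [] => x = r
  | x, e :: l => e.1 = x ∧ IsRoute r e.2 l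

/-- The arcs of `A` that leave the set `S`. -/
def leavingArcs {N : Type*} [DecidableEq N] (A : Finset (N × N)) (S : Finset N) :
    Finset (N × N) :=
  A.filter fun e => e.1 ∈ S ∧ e.2 ∉ S

/-- Submodularity of the cut function, checked arc by arc. -/
theorem card_leavingArcs_union_add_inter_le {N : Type*} [DecidableEq N] (A : Finset (N × N))
    (S T : Finset N) :
    (leavingArcs A (S ∪ T)).card + (leavingArcs A (S ∩ T)).card ≤
      (leavingArcs A S).card + (leavingArcs A T).card := by
  simp only [leavingArcs, Finset.card_filter, ← Finset.sum_add_distrib]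
  refine Finset.sum_le_sum fun e _ => ?_
  by_cases h1 : e.1 ∈ S <;> by_cases h2 : e.1 ∈ T <;> by_cases h3 : e.2 ∈ S <;>
    by_cases h4 : e.2 ∈ T <;> simp [h1, h2, h3, h4]

/-- Menger's theorem for tokens that travel to a common root along disjoint sets of arcs. -/
theorem exists_disjoint_routes {N T : Type*} [Fintype N] [DecidableEq N] [DecidableEq T]
    (r : N) (U : Finset T) (A : Finset (N × N)) (p : T → N)
    (h : ∀ S : Finset N, r ∉ S →
      (U.filter fun u => p u ∈ S).card ≤ (leavingArcs A S).card) :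
    ∃ L : T → List (N × N),
      (∀ u ∈ U, IsRoute r (p u) (L u) ∧ ∀ e ∈ L u, e ∈ A) ∧
      ∀ u ∈ U, ∀ v ∈ U, u ≠ v → List.Disjoint (L u) (L v) := by
  induction hk : A.card generalizing A p with
  | zero =>
    have hA : A = ∅ := Finset.card_eq_zero.mp hk
    subst hA
    refine ⟨fun _ => [], fun u hu => ⟨?_, by simp⟩, by simp⟩
    by_contra hne
    have hne' : p u ≠ r := hne
    have := h {p u} (by simpa using Ne.symm hne')
    have h0 : 0 < (U.filter fun v => p v ∈ ({p u} : Finset N)).card :=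
      Finset.card_pos.mpr ⟨u, by simp [hu]⟩
    simp [leavingArcs] at this
    exact absurd rfl (this hu)
  | succ k ih =>
    by_cases hdone : ∀ u ∈ U, p u = r
    · exact ⟨fun _ => [], fun u hu => ⟨hdone u hu, by simp⟩, by simp⟩
    push Not at hdone
    obtain ⟨u, hu, hur⟩ := hdone
    have hDmod : ∀ S T : Finset N,
        (U.filter fun u => p u ∈ S ∪ T).card + (U.filter fun u => p u ∈ S ∩ T).card =
        (U.filter fun u => p u ∈ S).card + (U.filter fun u => p u ∈ T).card := by
      intro S T
      simp only [Finset.card_filter, ← Finset.sum_add_distrib]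
      refine Finset.sum_congr rfl fun e _ => ?_
      by_cases h1 : p e ∈ S <;> by_cases h2 : p e ∈ T <;> simp [h1, h2]
    -- These are the sets that would be overfull if the token `u` moved into them. By submodularity
    -- they are closed under union, so the largest one, `M`, contains all others.
    let tight : Finset (Finset N) := Finset.univ.filter fun S =>
      r ∉ S ∧ p u ∉ S ∧ (U.filter fun u => p u ∈ S).card = (leavingArcs A S).card
    obtain ⟨M, hM, hmax⟩ := tight.exists_max_image Finset.card
      ⟨∅, Finset.mem_filter.mpr ⟨Finset.mem_univ _, by simp [leavingArcs]⟩⟩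
    have hMt : r ∉ M ∧ p u ∉ M ∧
      (U.filter fun u => p u ∈ M).card = (leavingArcs A M).card := by simpa [tight] using hM
    have hsub : ∀ S ∈ tight, S ⊆ M := by
      intro S hS
      have hSt : r ∉ S ∧ p u ∉ S ∧
        (U.filter fun u => p u ∈ S).card = (leavingArcs A S).card := by simpa [tight] using hS
      have hun : S ∪ M ∈ tight := by
        have h1 := h (S ∪ M) (by simp [hSt.1, hMt.1])
        have h2 := h (S ∩ M) (by simp [hSt.1])
        have h3 := card_leavingArcs_union_add_inter_le A S M
        have h4 := hDmod S M
        simp only [tight, Finset.mem_filter, Finset.mem_univ, true_and]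
        refine ⟨by simp [hSt.1, hMt.1], by simp [hSt.2.1, hMt.2.1], ?_⟩
        omega
      have h5 := hmax _ hun
      have h6 : M = S ∪ M := Finset.eq_of_subset_of_card_le Finset.subset_union_right h5
      rw [h6]
      exact Finset.subset_union_left
    -- If every arc out of `p u` ended in `M`, adding `p u` to `M` would add a token but no leaving
    -- arc, against the cut condition.
    obtain ⟨v, hv, hvM⟩ : ∃ v, (p u, v) ∈ A ∧ ∀ S ∈ tight, v ∉ S := by
      by_contra hcon
      push Not at hcon
      have hin : ∀ v, (p u, v) ∈ A → v ∈ M := fun v hv => by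
        obtain ⟨S, hS, hvS⟩ := hcon v hv
        exact hsub S hS hvS
      have h1 := h (insert (p u) M) (by simp [hMt.1, Ne.symm hur])
      have h2 : leavingArcs A (insert (p u) M) ⊆ leavingArcs A M := by
        intro e he
        simp only [leavingArcs, Finset.mem_filter, Finset.mem_insert, not_or] at he ⊢
        obtain ⟨heA, h3 | h3, h4, h5⟩ := he
        · exact absurd (hin e.2 (by rw [← h3]; exact heA)) h5
        · exact ⟨heA, h3, h5⟩
      have h3 : (U.filter fun w => p w ∈ M).card <
          (U.filter fun w => p w ∈ insert (p u) M).card := by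
        refine Finset.card_lt_card ⟨fun w hw => ?_, fun hss => ?_⟩
        · simp only [Finset.mem_filter, Finset.mem_insert] at hw ⊢
          exact ⟨hw.1, Or.inr hw.2⟩
        · have := hss (show u ∈ _ by simp [hu])
          exact hMt.2.1 (Finset.mem_filter.mp this).2
      have h4 := Finset.card_le_card h2
      omega
    have key : ∀ S : Finset N, r ∉ S →
        (U.filter fun w => Function.update p u v w ∈ S).card ≤
          (leavingArcs (A.erase (p u, v)) S).card := by
      intro S hr
      have hS := h S hr
      have hlv : leavingArcs (A.erase (p u, v)) S = (leavingArcs A S).erase (p u, v) := by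
        ext e
        simp only [leavingArcs, Finset.mem_filter, Finset.mem_erase]
        tauto
      rw [hlv]
      have hsplit : ∀ q : T → N, (U.filter fun w => q w ∈ S).card =
          (if q u ∈ S then 1 else 0) + ((U.erase u).filter fun w => q w ∈ S).card := by
        intro q
        rw [Finset.card_filter, Finset.card_filter, ← Finset.add_sum_erase _ _ hu]
      have hrest : ((U.erase u).filter fun w => Function.update p u v w ∈ S) =
          ((U.erase u).filter fun w => p w ∈ S) := by
        refine Finset.filter_congr fun w hw => ?_
        rw [Function.update_of_ne (Finset.ne_of_mem_erase hw)]
      rw [hsplit, hrest, Function.update_self]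
      rw [hsplit p] at hS
      -- Only a set containing `v` but not `p u` gains a token, and it has room because it is not
      -- tight. A set containing `p u` but not `v` loses one token and one arc.
      by_cases h1 : p u ∈ S <;> by_cases h2 : v ∈ S
      · have hnot : (p u, v) ∉ leavingArcs A S := by simp [leavingArcs, h2]
        rw [Finset.erase_eq_of_notMem hnot]
        simpa [h1, h2] using hS
      · have hmem : (p u, v) ∈ leavingArcs A S := by simp [leavingArcs, h1, h2, hv]
        rw [Finset.card_erase_of_mem hmem]
        simp only [h1, h2, if_true, if_false] at hS ⊢
        omega
      · have hnot : (p u, v) ∉ leavingArcs A S := by simp [leavingArcs, h2]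
        rw [Finset.erase_eq_of_notMem hnot]
        have hnt : S ∉ tight := fun hc => hvM S hc h2
        simp only [tight, Finset.mem_filter, Finset.mem_univ, true_and, hr, h1,
          not_false_eq_true] at hnt
        rw [hsplit p] at hnt
        simp only [h1, h2, if_true, if_false] at hS hnt ⊢
        omega
      · have hnot : (p u, v) ∉ leavingArcs A S := by simp [leavingArcs, h1]
        rw [Finset.erase_eq_of_notMem hnot]
        simpa [h1, h2] using hS
    obtain ⟨L, hL, hdisj⟩ := ih (A.erase (p u, v)) (Function.update p u v) key
      (by rw [Finset.card_erase_of_mem hv, hk]; rfl)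
    have hnot : ∀ w ∈ U, (p u, v) ∉ L w := fun w hw hmem =>
      Finset.notMem_erase _ _ ((hL w hw).2 _ hmem)
    refine ⟨fun w => if w = u then (p u, v) :: L u else L w, fun w hw => ?_,
      fun w hw w' hw' hne => ?_⟩
    · by_cases hwu : w = u
      · subst hwu
        have := hL w hw
        rw [Function.update_self] at this
        simp only [if_true, List.mem_cons]
        refine ⟨⟨rfl, this.1⟩, ?_⟩
        rintro e (rfl | he)
        · exact hv
        · exact Finset.mem_of_mem_erase (this.2 e he)
      · have := hL w hw
        rw [Function.update_of_ne hwu] at this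
        simp only [hwu, if_false]
        exact ⟨this.1, fun e he => Finset.mem_of_mem_erase (this.2 e he)⟩
    · by_cases hwu : w = u <;> by_cases hwu' : w' = u
      · exact absurd (hwu.trans hwu'.symm) hne
      · subst hwu
        simp only [if_true, hwu', if_false, List.disjoint_cons_left]
        exact ⟨hnot w' hw', hdisj w hw w' hw' hne⟩
      · subst hwu'
        simp only [if_true, hwu, if_false, List.disjoint_cons_right]
        exact ⟨hnot w hw, hdisj w hw w' hw' hne⟩
      · simp only [hwu, hwu', if_false]
        exact hdisj w hw w' hw' hne

/-! ### Clique immersions as families of disjoint edge sets -/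

/-- The vertices of `U` are branch vertices of a clique immersion inside `A`: distinct pairs of
vertices own disjoint sets of edges inside `A`, and the edges owned by a pair of branch vertices
connect them. -/
def CliqueLinked {V : Type*} (G : SimpleGraph V) (A U : Finset V) : Prop :=
  U ⊆ A ∧ ∃ F : Sym2 V → Set (Sym2 V),
    (∀ e, ∀ f ∈ F e, f ∈ G.edgeSet ∧ ∀ x ∈ f, x ∈ A) ∧
    (∀ e e', e ≠ e' → Disjoint (F e) (F e')) ∧
    ∀ u ∈ U, ∀ v ∈ U, u ≠ v → (SimpleGraph.fromEdgeSet (F s(u, v))).Reachable u v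

theorem CliqueLinked.empty {V : Type*} (G : SimpleGraph V) (A : Finset V) :
    CliqueLinked G A ∅ :=
  ⟨by simp, fun _ => ∅, by simp, by simp, by simp⟩

theorem CliqueLinked.of_pairwise_adj {V : Type*} {G : SimpleGraph V} {A U : Finset V}
    (hUA : U ⊆ A) (hU : ∀ u ∈ U, ∀ v ∈ U, u ≠ v → G.Adj u v) : CliqueLinked G A U := by
  refine ⟨hUA, fun e => {f | f = e ∧ e ∈ G.edgeSet ∧ ∀ x ∈ e, x ∈ A}, ?_, ?_, ?_⟩
  · rintro e f ⟨rfl, h1, h2⟩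
    exact ⟨h1, h2⟩
  · intro e e' hne
    rw [Set.disjoint_left]
    rintro f ⟨rfl, -⟩ ⟨h, -⟩
    exact hne h
  · intro u hu v hv huv
    refine SimpleGraph.Adj.reachable ?_
    rw [SimpleGraph.fromEdgeSet_adj]
    refine ⟨⟨rfl, hU u hu v hv huv, ?_⟩, huv⟩
    intro x hx
    rcases Sym2.mem_iff.mp hx with rfl | rfl
    · exact hUA hu
    · exact hUA hv

theorem CliqueLinked.mono {V : Type*} {G : SimpleGraph V} {A A' U U' : Finset V}
    (h : CliqueLinked G A' U) (hA : A' ⊆ A) (hU : U' ⊆ U) : CliqueLinked G A U' := by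
  obtain ⟨h1, F, h2, h3, h4⟩ := h
  exact ⟨(hU.trans h1).trans hA, F,
    fun e f hf => ⟨(h2 e f hf).1, fun x hx => hA ((h2 e f hf).2 x hx)⟩, h3,
    fun u hu v hv => h4 u (hU hu) v (hU hv)⟩

/-- New branch vertices `B` can be added if they are linked by edges not inside `A'`. -/
theorem CliqueLinked.union {V : Type*} [DecidableEq V] {G : SimpleGraph V} {A A' U B : Finset V}
    (hU : CliqueLinked G A' U) (hA : A' ⊆ A) (hB : B ⊆ A) (H : Sym2 V → Set (Sym2 V))
    (hH : ∀ e, ∀ f ∈ H e, f ∈ G.edgeSet ∧ (∀ x ∈ f, x ∈ A) ∧ ∃ x ∈ f, x ∉ A')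
    (hd : ∀ e e', e ≠ e' → Disjoint (H e) (H e'))
    (hr : ∀ b ∈ B, ∀ u ∈ U ∪ B, b ≠ u → (SimpleGraph.fromEdgeSet (H s(b, u))).Reachable b u) :
    CliqueLinked G A (U ∪ B) := by
  obtain ⟨h1, F, h2, h3, h4⟩ := hU
  have hFH : ∀ e e', Disjoint (F e) (H e') := by
    intro e e'
    rw [Set.disjoint_left]
    intro f hf hf'
    obtain ⟨-, -, x, hx, hx'⟩ := hH e' f hf'
    exact hx' ((h2 e f hf).2 x hx)
  refine ⟨Finset.union_subset (h1.trans hA) hB, fun e => F e ∪ H e, ?_, ?_, ?_⟩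
  · rintro e f (hf | hf)
    · exact ⟨(h2 e f hf).1, fun x hx => hA ((h2 e f hf).2 x hx)⟩
    · exact ⟨(hH e f hf).1, (hH e f hf).2.1⟩
  · intro e e' hne
    rw [Set.disjoint_union_left, Set.disjoint_union_right, Set.disjoint_union_right]
    exact ⟨⟨h3 e e' hne, hFH e e'⟩, (hFH e' e).symm, hd e e' hne⟩
  · have hnew : ∀ b ∈ B, ∀ u ∈ U ∪ B, b ≠ u →
        (SimpleGraph.fromEdgeSet (F s(b, u) ∪ H s(b, u))).Reachable b u := fun b hb u hu hne =>
      (hr b hb u hu hne).mono (SimpleGraph.fromEdgeSet_mono Set.subset_union_right)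
    intro u hu v hv huv
    by_cases huB : u ∈ B
    · exact hnew u huB v hv huv
    by_cases hvB : v ∈ B
    · have := (hnew v hvB u hu huv.symm).symm
      rwa [Sym2.eq_swap] at this
    · have hu' : u ∈ U := by simpa [huB] using hu
      have hv' : v ∈ U := by simpa [hvB] using hv
      exact (h4 u hu' v hv' huv).mono (SimpleGraph.fromEdgeSet_mono Set.subset_union_left)

/-! ### Adding one vertex of a dominating set -/

/-- The vertex `w` has a neighbour in `Y`. -/
def Meets {V : Type*} (G : SimpleGraph V) (w : V) (Y : Finset V) : Prop :=
  ∃ a ∈ Y, G.Adj w a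

/-- The arcs of the digraph in which every vertex `w ∈ C` is split into an entry `inl w` and an
exit `inr w`, and the vertices of `W` can be left towards `I`. -/
def IsConnectorArc {V : Type*} (G : SimpleGraph V) (I C W : Finset V)
    (e : (V ⊕ V) × (V ⊕ V)) : Prop :=
  (∃ a w, a ∈ I ∧ w ∈ C ∧ G.Adj w a ∧ e = (Sum.inl a, Sum.inl w)) ∨
  (∃ w, w ∈ C ∧ e = (Sum.inl w, Sum.inr w)) ∨
  (∃ w a, a ∈ I ∧ w ∈ W ∧ G.Adj w a ∧ e = (Sum.inr w, Sum.inl a))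

/-- The edges of `G` between `I` and `T`. -/
def edgesBetween {V : Type*} (G : SimpleGraph V) (I : Finset V) (T : Set V) : Set (Sym2 V) :=
  {f | ∃ w ∈ T, ∃ a ∈ I, G.Adj w a ∧ f = s(w, a)}

/-- A route that enters `inl w` with `w` outside `I` can only continue by the arc from `inl w` to
`inr w`. So every vertex outside `I` that it visits is in `T`, and the route projects to a walk
along edges between `I` and `T`. -/
theorem reachable_of_isRoute {V : Type*} {G : SimpleGraph V} {I C W : Finset V} {b : V}
    (hb : b ∈ I) (hC : ∀ w ∈ C, w ∉ I) {T : Set V} (l : List ((V ⊕ V) × (V ⊕ V)))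
    (x : V ⊕ V) (hl : IsRoute (Sum.inl b) x l) (harc : ∀ e ∈ l, IsConnectorArc G I C W e)
    (hT : ∀ w, (Sum.inl w, Sum.inr w) ∈ l → w ∈ T) (hx : ∀ w, x = Sum.inr w → w ∈ T) :
    (SimpleGraph.fromEdgeSet (edgesBetween G I T)).Reachable (Sum.elim id id x) b := by
  have hadj : ∀ w ∈ T, ∀ a ∈ I, G.Adj w a →
      (SimpleGraph.fromEdgeSet (edgesBetween G I T)).Reachable w a := by
    intro w hw a ha h
    refine SimpleGraph.Adj.reachable ?_
    rw [SimpleGraph.fromEdgeSet_adj]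
    exact ⟨⟨w, hw, a, ha, h, rfl⟩, h.ne⟩
  induction l generalizing x with
  | nil =>
    have : x = Sum.inl b := hl
    subst this
    exact SimpleGraph.Reachable.refl _
  | cons e l ih =>
    obtain ⟨rfl, hl⟩ := hl
    have ih' := ih e.2 hl (fun e' he' => harc e' (List.mem_cons_of_mem _ he'))
      (fun w hw => hT w (List.mem_cons_of_mem _ hw))
    rcases harc e List.mem_cons_self with
      ⟨a, w, ha, hw, h, rfl⟩ | ⟨w, hw, rfl⟩ | ⟨w, a, ha, hw, h, rfl⟩
    · have hwT : w ∈ T := by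
        cases l with
        | nil =>
          have : (Sum.inl w : V ⊕ V) = Sum.inl b := hl
          rw [Sum.inl.injEq] at this
          exact absurd (this ▸ hb) (hC w hw)
        | cons e' l' =>
          have he' : e'.1 = Sum.inl w := hl.1
          rcases harc e' (by simp) with
            ⟨a', w', ha', -, -, rfl⟩ | ⟨w', -, rfl⟩ | ⟨w', a', -, -, -, rfl⟩
          · rw [Sum.inl.injEq] at he'
            exact absurd (he' ▸ ha') (hC w hw)
          · rw [Sum.inl.injEq] at he'
            subst he'
            exact hT w' (by simp)
          · simp at he'
      exact (hadj w hwT a ha h).symm.trans (ih' (by simp))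
    · refine ih' ?_
      rintro w' h'
      rw [Sum.inr.injEq] at h'
      subst h'
      exact hT w List.mem_cons_self
    · exact (hadj w (hx w rfl) a ha h).trans (ih' (by simp))

open Classical in
/-- A clique immersion avoiding a dominating set `I` extends to a vertex `b ∈ I` if every part of
`I` that avoids `b` is joined to the rest of `I` by sufficiently many vertices outside `I`. -/
theorem CliqueLinked.union_singleton_of_crossing {V : Type*} [Fintype V] {G : SimpleGraph V}
    {A I U : Finset V} {b : V} (hIA : I ⊆ A) (hb : b ∈ I) (hU : CliqueLinked G (A \ I) U)
    (hdom : ∀ u ∈ U, Meets G u I)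
    (hcross : ∀ Y ⊆ I, Y.Nonempty → b ∉ Y →
      U.card ≤ ((A \ I).filter fun w => Meets G w Y ∧ Meets G w (I \ Y)).card) :
    CliqueLinked G A (U ∪ {b}) := by
  have hUA : U ⊆ A \ I := hU.1
  let C := (A \ I) \ U
  have hC : ∀ w ∈ C, w ∉ I := fun w hw =>
    (Finset.mem_sdiff.mp (Finset.mem_sdiff.mp hw).1).2
  let arcs : Finset ((V ⊕ V) × (V ⊕ V)) :=
    Finset.univ.filter fun e => IsConnectorArc G I C (A \ I) e
  have harcs : ∀ e, e ∈ arcs ↔ IsConnectorArc G I C (A \ I) e := fun e => by simp [arcs]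
  -- The endpoint of an arc outside `I`. Distinct owners have distinct arcs, so leaving arcs can be
  -- counted from below by their owners.
  let owner : (V ⊕ V) × (V ⊕ V) → V := fun e =>
    Sum.elim (fun x => Sum.elim id (fun _ => x) e.2) id e.1
  obtain ⟨L, hL, hdisj⟩ := exists_disjoint_routes (Sum.inl b) U arcs (fun u => Sum.inr u) (by
    intro S hbS
    let Y := I.filter fun a => (Sum.inl a : V ⊕ V) ∈ S
    have hYI : Y ⊆ I := Finset.filter_subset _ _
    have hbY : b ∉ Y := by simp [Y, hbS]
    have hX : ∀ a, a ∈ I \ Y ↔ a ∈ I ∧ (Sum.inl a : V ⊕ V) ∉ S := by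
      intro a
      simp only [Y, Finset.mem_sdiff, Finset.mem_filter]
      tauto
    have hYm : ∀ a, a ∈ Y ↔ a ∈ I ∧ (Sum.inl a : V ⊕ V) ∈ S := by simp [Y]
    let US := U.filter fun u => (Sum.inr u : V ⊕ V) ∈ S
    -- Each vertex of `D` or `P` owns an arc leaving `S`. The tokens in `Q` own none for certain and
    -- have to be paid for by `D`.
    let D := C.filter fun w => Meets G w Y ∧ Meets G w (I \ Y)
    let P := US.filter fun u => Meets G u (I \ Y)
    let Q := US.filter fun u => ¬ Meets G u (I \ Y)
    have hPQ : P.card + Q.card = US.card := Finset.card_filter_add_card_filter_not _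
    have hsub : D ∪ P ⊆ (leavingArcs arcs S).image owner := by
      intro w hw
      rw [Finset.mem_image]
      rcases Finset.mem_union.mp hw with hw | hw
      · obtain ⟨hwC, ⟨y, hy, hwy⟩, x, hx, hwx⟩ := Finset.mem_filter.mp hw
        have hwA : w ∈ A \ I := (Finset.mem_sdiff.mp hwC).1
        rw [hX] at hx
        rw [hYm] at hy
        by_cases h1 : (Sum.inl w : V ⊕ V) ∈ S
        · by_cases h2 : (Sum.inr w : V ⊕ V) ∈ S
          · refine ⟨(Sum.inr w, Sum.inl x), ?_, rfl⟩
            refine Finset.mem_filter.mpr ⟨(harcs _).mpr ?_, h2, hx.2⟩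
            exact Or.inr (Or.inr ⟨w, x, hx.1, hwA, hwx, rfl⟩)
          · refine ⟨(Sum.inl w, Sum.inr w), ?_, rfl⟩
            refine Finset.mem_filter.mpr ⟨(harcs _).mpr ?_, h1, h2⟩
            exact Or.inr (Or.inl ⟨w, hwC, rfl⟩)
        · refine ⟨(Sum.inl y, Sum.inl w), ?_, rfl⟩
          refine Finset.mem_filter.mpr ⟨(harcs _).mpr ?_, hy.2, h1⟩
          exact Or.inl ⟨y, w, hy.1, hwC, hwy, rfl⟩
      · obtain ⟨hwS, x, hx, hwx⟩ := Finset.mem_filter.mp hw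
        obtain ⟨hwU, hwS⟩ := Finset.mem_filter.mp hwS
        rw [hX] at hx
        refine ⟨(Sum.inr w, Sum.inl x), ?_, rfl⟩
        refine Finset.mem_filter.mpr ⟨(harcs _).mpr ?_, hwS, hx.2⟩
        exact Or.inr (Or.inr ⟨w, x, hx.1, hUA hwU, hwx, rfl⟩)
    have hDP : Disjoint D P := by
      rw [Finset.disjoint_left]
      intro w hw hw'
      exact (Finset.mem_sdiff.mp (Finset.mem_filter.mp hw).1).2
        (Finset.mem_filter.mp (Finset.mem_filter.mp hw').1).1
    have hcard : D.card + P.card ≤ (leavingArcs arcs S).card := by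
      rw [← Finset.card_union_of_disjoint hDP]
      exact (Finset.card_le_card hsub).trans Finset.card_image_le
    have hQD : Q.card ≤ D.card := by
      rcases Q.eq_empty_or_nonempty with hQ | ⟨u, hu⟩
      · simp [hQ]
      obtain ⟨huS, hun⟩ := Finset.mem_filter.mp hu
      have huU := (Finset.mem_filter.mp huS).1
      have hYne : Y.Nonempty := by
        obtain ⟨a, ha, hua⟩ := hdom u huU
        by_contra hY
        exact hun ⟨a, Finset.mem_sdiff.mpr ⟨ha, fun h => hY ⟨a, h⟩⟩, hua⟩
      have h1 := hcross Y hYI hYne hbY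
      -- At least `U.card` vertices meet both sides, and those not in `D` lie in `R`. As `Q` and `R`
      -- are disjoint parts of `U`, this gives `Q.card ≤ D.card`.
      let R := U.filter fun w => Meets G w Y ∧ Meets G w (I \ Y)
      have h2 : ((A \ I).filter fun w => Meets G w Y ∧ Meets G w (I \ Y)) ⊆ D ∪ R := by
        intro w hw
        obtain ⟨hw1, hw2⟩ := Finset.mem_filter.mp hw
        by_cases hwU : w ∈ U
        · exact Finset.mem_union_right _ (Finset.mem_filter.mpr ⟨hwU, hw2⟩)
        · exact Finset.mem_union_left _
            (Finset.mem_filter.mpr ⟨Finset.mem_sdiff.mpr ⟨hw1, hwU⟩, hw2⟩)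
      have h3 := (Finset.card_le_card h2).trans (Finset.card_union_le _ _)
      have hQR : Disjoint Q R := by
        rw [Finset.disjoint_left]
        intro w hw hw'
        exact (Finset.mem_filter.mp hw).2 (Finset.mem_filter.mp hw').2.2
      have h4 : Q.card + R.card ≤ U.card := by
        rw [← Finset.card_union_of_disjoint hQR]
        exact Finset.card_le_card (Finset.union_subset
          ((Finset.filter_subset _ _).trans (Finset.filter_subset _ _))
          (Finset.filter_subset _ _))
      omega
    change US.card ≤ _
    omega)
  -- The vertices outside `I` used by the route of `u`. These sets are disjoint for distinct tokens
  -- because the arc inside a split vertex is used only once, so the edges towards `I` are disjoint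
  -- too.
  let T : V → Set V := fun u => {w | w = u ∨ (w ∈ C ∧ (Sum.inl w, Sum.inr w) ∈ L u)}
  have hTA : ∀ u ∈ U, ∀ w ∈ T u, w ∈ A \ I := by
    rintro u hu w (rfl | ⟨hw, -⟩)
    · exact hUA hu
    · exact (Finset.mem_sdiff.mp hw).1
  have hTd : ∀ u ∈ U, ∀ v ∈ U, u ≠ v → ∀ w, w ∈ T u → w ∉ T v := by
    rintro u hu v hv huv w (rfl | ⟨hw, hw'⟩) (rfl | ⟨hv', hv''⟩)
    · exact huv rfl
    · exact (Finset.mem_sdiff.mp hv').2 hu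
    · exact (Finset.mem_sdiff.mp hw).2 hv
    · exact hdisj u hu v hv huv hw' hv''
  refine hU.union (B := {b}) Finset.sdiff_subset (by simpa using hIA hb)
    (fun e => {f | ∃ u ∈ U, e = s(b, u) ∧ f ∈ edgesBetween G I (T u)}) ?_ ?_ ?_
  · rintro e f ⟨u, hu, rfl, w, hw, a, ha, hwa, rfl⟩
    refine ⟨hwa, fun x hx => ?_, a, by simp, fun h => (Finset.mem_sdiff.mp h).2 ha⟩
    rcases Sym2.mem_iff.mp hx with rfl | rfl
    · exact (Finset.mem_sdiff.mp (hTA u hu x hw)).1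
    · exact hIA ha
  · intro e e' hne
    rw [Set.disjoint_left]
    rintro f ⟨u, hu, rfl, w, hw, a, ha, hwa, rfl⟩ ⟨v, hv, rfl, w', hw', a', ha', hwa', hf⟩
    have huv : u ≠ v := fun h => hne (by rw [h])
    rcases Sym2.eq_iff.mp hf with ⟨rfl, rfl⟩ | ⟨rfl, rfl⟩
    · exact hTd u hu v hv huv w hw hw'
    · exact (Finset.mem_sdiff.mp (hTA u hu w hw)).2 ha'
  · intro b' hb' u hu hne
    rw [Finset.mem_singleton] at hb'
    subst hb'
    have huU : u ∈ U := by
      rcases Finset.mem_union.mp hu with h | h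
      · exact h
      · exact absurd (Finset.mem_singleton.mp h).symm hne
    have hreach := reachable_of_isRoute (G := G) (T := T u) hb hC (L u) (Sum.inr u)
      (hL u huU).1 (fun e he => (harcs e).mp ((hL u huU).2 e he)) (by
        intro w hw
        refine Or.inr ⟨?_, hw⟩
        rcases (harcs _).mp ((hL u huU).2 _ hw) with
          ⟨_, _, _, _, _, h⟩ | ⟨w', hw', h⟩ | ⟨_, _, _, _, _, h⟩
        · simp at h
        · simp only [Prod.mk.injEq, Sum.inl.injEq] at h
          exact h.1 ▸ hw'
        · simp at h)
      (by
        intro w hw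
        exact Or.inl (Sum.inr.inj hw).symm)
    refine hreach.symm.mono (SimpleGraph.fromEdgeSet_mono ?_)
    intro f hf
    exact ⟨u, huU, rfl, hf⟩

/-! ### Adding two vertices of a five-hole -/

/-- New branch vertices `b i` can be added if every old branch vertex `u` leaves through its own
port `d i u` of `B` and, unless the port is `b i`, continues to `b i` through a private vertex
`g i u`. -/
theorem CliqueLinked.union_of_ports {V ι : Type*} [DecidableEq V] [Fintype ι] {G : SimpleGraph V}
    {A B U : Finset V} (hB : B ⊆ A) (hU : CliqueLinked G (A \ B) U) (b : ι → V) (d g : ι → V → V)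
    (E : ι → Finset V) (hbB : ∀ i, b i ∈ B)
    (hbb : ∀ i j, i ≠ j → G.Adj (b i) (b j))
    (hdB : ∀ i, ∀ u ∈ U, d i u ∈ B) (hud : ∀ i, ∀ u ∈ U, G.Adj u (d i u))
    (hdd : ∀ i j, ∀ u ∈ U, i ≠ j → d i u ≠ d j u)
    (hdE : ∀ i, ∀ u ∈ U, u ∉ E i → d i u = b i)
    (hg : ∀ i, ∀ u ∈ E i, g i u ∈ (A \ B) \ U ∧ G.Adj (g i u) (d i u) ∧ G.Adj (g i u) (b i))
    (hginj : ∀ i j, ∀ u ∈ E i, ∀ v ∈ E j, g i u = g j v → i = j ∧ u = v) :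
    CliqueLinked G A (U ∪ Finset.univ.image b) := by
  have hUAB : ∀ u ∈ U, u ∈ A ∧ u ∉ B := fun u hu => Finset.mem_sdiff.mp (hU.1 hu)
  have hgAB : ∀ i, ∀ u ∈ E i, (g i u ∈ A ∧ g i u ∉ B) ∧ g i u ∉ U := fun i u hu => by
    simpa [Finset.mem_sdiff] using (hg i u hu).1
  let R : ι → V → V → V → Prop := fun i u x y =>
    (x = u ∧ y = d i u) ∨ (u ∈ E i ∧ x = g i u ∧ (y = d i u ∨ y = b i))
  have hR : ∀ i, ∀ u ∈ U, ∀ x y, R i u x y → G.Adj x y ∧ x ∈ A ∧ x ∉ B ∧ y ∈ B := by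
    rintro i u hu x y (⟨rfl, rfl⟩ | ⟨hE, rfl, rfl | rfl⟩)
    · exact ⟨hud i _ hu, (hUAB _ hu).1, (hUAB _ hu).2, hdB i _ hu⟩
    · exact ⟨(hg i u hE).2.1, (hgAB i u hE).1.1, (hgAB i u hE).1.2, hdB i _ hu⟩
    · exact ⟨(hg i u hE).2.2, (hgAB i u hE).1.1, (hgAB i u hE).1.2, hbB i⟩
  -- The endpoint outside `B` is either an old branch vertex, whose ports for different `i` differ,
  -- or a helper private to one pair of `i` and `u`.
  have hRinj : ∀ i j, ∀ u ∈ U, ∀ v ∈ U, ∀ x y, R i u x y → R j v x y → i = j ∧ u = v := by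
    rintro i j u hu v hv x y (⟨rfl, rfl⟩ | ⟨hE, rfl, -⟩) (⟨rfl, h⟩ | ⟨hE', h, -⟩)
    · refine ⟨?_, rfl⟩
      by_contra hij
      exact hdd i j _ hu hij h
    · exact absurd (h ▸ hu) (hgAB j v hE').2
    · exact absurd hv (hgAB i u hE).2
    · exact hginj i j u hE v hE' h
  refine hU.union Finset.sdiff_subset (by
      intro x hx
      obtain ⟨i, -, rfl⟩ := Finset.mem_image.mp hx
      exact hB (hbB i))
    (fun e => {f | (∃ i j, i ≠ j ∧ e = s(b i, b j) ∧ f = e) ∨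
      ∃ i, ∃ u ∈ U, e = s(b i, u) ∧ ∃ x y, R i u x y ∧ f = s(x, y)}) ?_ ?_ ?_
  · rintro e f (⟨i, j, hij, rfl, rfl⟩ | ⟨i, u, hu, rfl, x, y, hxy, rfl⟩)
    · refine ⟨hbb i j hij, fun x hx => ?_, b i, by simp,
        fun h => (Finset.mem_sdiff.mp h).2 (hbB i)⟩
      rcases Sym2.mem_iff.mp hx with rfl | rfl
      · exact hB (hbB i)
      · exact hB (hbB j)
    · obtain ⟨h1, h2, h3, h4⟩ := hR i u hu x y hxy
      refine ⟨h1, fun z hz => ?_, y, by simp, fun h => (Finset.mem_sdiff.mp h).2 h4⟩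
      rcases Sym2.mem_iff.mp hz with rfl | rfl
      · exact h2
      · exact hB h4
  · intro e e' hne
    rw [Set.disjoint_left]
    rintro f (⟨i, j, hij, rfl, rfl⟩ | ⟨i, u, hu, rfl, x, y, hxy, rfl⟩)
      (⟨i', j', hij', rfl, hf⟩ | ⟨i', u', hu', rfl, x', y', hxy', hf⟩)
    · exact hne hf
    · obtain ⟨h1, h2, h3, h4⟩ := hR i' u' hu' x' y' hxy'
      rcases Sym2.eq_iff.mp hf with ⟨h, -⟩ | ⟨-, h⟩
      · exact h3 (h ▸ hbB i)
      · exact h3 (h ▸ hbB j)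
    · obtain ⟨h1, h2, h3, h4⟩ := hR i u hu x y hxy
      rcases Sym2.eq_iff.mp hf with ⟨h, -⟩ | ⟨h, -⟩
      · exact h3 (h ▸ hbB i')
      · exact h3 (h ▸ hbB j')
    · obtain ⟨h1, h2, h3, h4⟩ := hR i u hu x y hxy
      obtain ⟨h1', h2', h3', h4'⟩ := hR i' u' hu' x' y' hxy'
      rcases Sym2.eq_iff.mp hf with ⟨rfl, rfl⟩ | ⟨rfl, rfl⟩
      · obtain ⟨rfl, rfl⟩ := hRinj i i' u hu u' hu' _ _ hxy hxy'
        exact hne rfl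
      · exact h3 h4'
  · intro x hx u hu hne
    obtain ⟨i, -, rfl⟩ := Finset.mem_image.mp hx
    rcases Finset.mem_union.mp hu with huU | hub
    · have hadj : ∀ x y, R i u x y → (SimpleGraph.fromEdgeSet
          {f | (∃ i' j, i' ≠ j ∧ s(b i, u) = s(b i', b j) ∧ f = s(b i, u)) ∨
            ∃ i', ∃ u' ∈ U, s(b i, u) = s(b i', u') ∧
              ∃ x y, R i' u' x y ∧ f = s(x, y)}).Reachable x y := by
        intro x y hxy
        refine SimpleGraph.Adj.reachable ?_
        rw [SimpleGraph.fromEdgeSet_adj]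
        exact ⟨Or.inr ⟨i, u, huU, rfl, x, y, hxy, rfl⟩, (hR i u huU x y hxy).1.ne⟩
      have h1 := hadj u (d i u) (Or.inl ⟨rfl, rfl⟩)
      by_cases hE : u ∈ E i
      · have h2 := hadj (g i u) (d i u) (Or.inr ⟨hE, rfl, Or.inl rfl⟩)
        have h3 := hadj (g i u) (b i) (Or.inr ⟨hE, rfl, Or.inr rfl⟩)
        exact (h1.trans (h2.symm.trans h3)).symm
      · rw [hdE i u huU hE] at h1
        exact h1.symm
    · obtain ⟨j, -, rfl⟩ := Finset.mem_image.mp hub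
      refine SimpleGraph.Adj.reachable ?_
      rw [SimpleGraph.fromEdgeSet_adj]
      refine ⟨Or.inl ⟨i, j, ?_, rfl, rfl⟩, hne⟩
      rintro rfl
      exact hne rfl

/-- Two families of demands are served injectively from two sets of resources. -/
theorem exists_injective_assignment {V : Type*} [DecidableEq V] (E Λ : Bool → Finset V)
    (h : ∀ i, (E i).card ≤ (Λ i).card)
    (h' : (E true).card + (E false).card ≤ (Λ true ∪ Λ false).card) :
    ∃ g : Bool → V → V, (∀ i, ∀ u ∈ E i, g i u ∈ Λ i) ∧
      ∀ i j, ∀ u ∈ E i, ∀ v ∈ E j, g i u = g j v → i = j ∧ u = v := by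
  -- All demands of one family accept the same resources, so Hall's condition only depends on which
  -- of the two families occur in `s`.
  have hall : ∀ s : Finset {p : Bool × V // p.2 ∈ E p.1},
      s.card ≤ (s.biUnion fun p => Λ p.1.1).card := by
    intro s
    have hpart : ∀ i, (s.filter fun p => p.1.1 = i).card ≤ (E i).card := by
      intro i
      refine Finset.card_le_card_of_injOn (fun p => p.1.2) ?_ ?_
      · intro p hp
        have := (Finset.mem_filter.mp hp).2
        exact this ▸ p.2
      · intro p hp q hq hpq
        have h1 := (Finset.mem_filter.mp hp).2
        have h2 := (Finset.mem_filter.mp hq).2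
        exact Subtype.ext (Prod.ext (h1.trans h2.symm) hpq)
    have hsplit : s.card = (s.filter fun p => p.1.1 = true).card +
        (s.filter fun p => p.1.1 = false).card := by
      rw [← Finset.card_filter_add_card_filter_not (s := s) (fun p => p.1.1 = true)]
      simp
    have hsub : ∀ i, (s.filter fun p => p.1.1 = i).Nonempty →
        Λ i ⊆ s.biUnion fun p => Λ p.1.1 := by
      rintro i ⟨p, hp⟩ x hx
      obtain ⟨hp1, rfl⟩ := Finset.mem_filter.mp hp
      exact Finset.mem_biUnion.mpr ⟨p, hp1, hx⟩
    have h1 := hpart true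
    have h2 := hpart false
    have h3 := h true
    have h4 := h false
    rcases Finset.eq_empty_or_nonempty (s.filter fun p => p.1.1 = true) with e1 | n1 <;>
      rcases Finset.eq_empty_or_nonempty (s.filter fun p => p.1.1 = false) with e2 | n2
    · rw [hsplit, e1, e2]
      simp
    · have := Finset.card_le_card (hsub _ n2)
      rw [e1, Finset.card_empty] at hsplit
      omega
    · have := Finset.card_le_card (hsub _ n1)
      rw [e2, Finset.card_empty] at hsplit
      omega
    · have := Finset.card_le_card (Finset.union_subset (hsub _ n1) (hsub _ n2))
      omega
  obtain ⟨f, hf, hfm⟩ := (Finset.all_card_le_biUnion_card_iff_exists_injective _).mp hall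
  refine ⟨fun i u => if hu : u ∈ E i then f ⟨(i, u), hu⟩ else u, ?_, ?_⟩
  · intro i u hu
    simpa [hu] using hfm ⟨(i, u), hu⟩
  · intro i j u hu v hv huv
    simp only [hu, hv, dif_pos] at huv
    have := hf huv
    simpa using this

/-- The vertices of `B` form an induced cycle `v₁ v₂ v₃ v₄ v₅` of `G`. -/
structure FiveHole {V : Type*} (G : SimpleGraph V) (B : Finset V) (v₁ v₂ v₃ v₄ v₅ : V) :
    Prop where
  mem : v₁ ∈ B ∧ v₂ ∈ B ∧ v₃ ∈ B ∧ v₄ ∈ B ∧ v₅ ∈ B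
  adj : G.Adj v₁ v₂ ∧ G.Adj v₂ v₃ ∧ G.Adj v₃ v₄ ∧ G.Adj v₄ v₅ ∧ G.Adj v₅ v₁
  compl : Gᶜ.Adj v₁ v₃ ∧ Gᶜ.Adj v₂ v₄ ∧ Gᶜ.Adj v₃ v₅ ∧ Gᶜ.Adj v₄ v₁ ∧ Gᶜ.Adj v₅ v₂

theorem FiveHole.rotate {V : Type*} {G : SimpleGraph V} {B : Finset V} {v₁ v₂ v₃ v₄ v₅ : V}
    (h : FiveHole G B v₁ v₂ v₃ v₄ v₅) : FiveHole G B v₂ v₃ v₄ v₅ v₁ := by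
  obtain ⟨⟨h1, h2, h3, h4, h5⟩, ⟨a1, a2, a3, a4, a5⟩, ⟨c1, c2, c3, c4, c5⟩⟩ := h
  exact ⟨⟨h2, h3, h4, h5, h1⟩, ⟨a2, a3, a4, a5, a1⟩, ⟨c2, c3, c4, c5, c1⟩⟩

/-- Among any three vertices of `A` two are adjacent. -/
def NoIndepTriple {V : Type*} (G : SimpleGraph V) (A : Finset V) : Prop :=
  ∀ x ∈ A, ∀ y ∈ A, ∀ z ∈ A, Gᶜ.Adj x y → Gᶜ.Adj y z → ¬ Gᶜ.Adj x z

open Classical in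
/-- A clique immersion avoiding a five-hole `B` extends to the two consecutive vertices `v₁`, `v₂`
of `B` if few vertices miss two consecutive vertices of `B` at certain places. -/
theorem FiveHole.cliqueLinked_union {V : Type*} {G : SimpleGraph V} {A B U : Finset V}
    {v₁ v₂ v₃ v₄ v₅ : V} {t : ℕ} (hC : FiveHole G B v₁ v₂ v₃ v₄ v₅) (hBA : B ⊆ A)
    (hB5 : B.card = 5) (hα : NoIndepTriple G A)
    (hω : ∀ s ⊆ A, (∀ x ∈ s, ∀ y ∈ s, ¬ Gᶜ.Adj x y) → s.card + 1 ≤ t)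
    (hU : CliqueLinked G (A \ B) U) (hUt : U.card + 2 = t)
    (hK₁ : ((A \ B).filter fun w => ¬ G.Adj w v₃ ∧ ¬ G.Adj w v₄).card + 2 * t + 1 ≤ A.card)
    (hK₂ : ((A \ B).filter fun w => ¬ G.Adj w v₄ ∧ ¬ G.Adj w v₅).card + 2 * t + 1 ≤ A.card)
    (hK₄ : ((A \ B).filter fun w => ¬ G.Adj w v₁ ∧ ¬ G.Adj w v₂).card + 2 * t + 1 ≤ A.card) :
    CliqueLinked G A (U ∪ {v₁, v₂}) := by
  obtain ⟨⟨m1, m2, m3, m4, m5⟩, ⟨a12, a23, a34, a45, a51⟩, ⟨c13, c24, c35, c41, c52⟩⟩ := hC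
  -- Hence the hole vertices not adjacent to an outside vertex are pairwise adjacent: at most two,
  -- and consecutive.
  have hmiss : ∀ w ∈ A \ B, ∀ x ∈ B, ∀ y ∈ B, Gᶜ.Adj x y → G.Adj w x ∨ G.Adj w y := by
    intro w hw x hx y hy hxy
    obtain ⟨hwA, hwB⟩ := Finset.mem_sdiff.mp hw
    by_contra hcon
    push Not at hcon
    refine hα x (hBA hx) y (hBA hy) w hwA hxy ?_ ?_
    · rw [SimpleGraph.compl_adj]
      exact ⟨fun h => hwB (h ▸ hy), fun h => hcon.2 h.symm⟩
    · rw [SimpleGraph.compl_adj]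
      exact ⟨fun h => hwB (h ▸ hx), fun h => hcon.1 h.symm⟩
  have hUAB := hU.1
  let N := (A \ B) \ U
  have hNAB : N ⊆ A \ B := Finset.sdiff_subset
  have hN : N.card + U.card + 5 = A.card := by
    have h1 := Finset.card_sdiff_add_card_eq_card hUAB
    have h2 := Finset.card_sdiff_add_card_eq_card hBA
    have h3 : N.card = ((A \ B) \ U).card := rfl
    omega
  let E : Bool → Finset V := fun i =>
    U.filter fun u => ¬ G.Adj u (cond i v₁ v₂)
  -- Possible helpers. A branch vertex not adjacent to `v₁` sees `v₃` and `v₄`, and one not adjacent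
  -- to `v₂` sees `v₄` and `v₅`, so a helper needs only one of the two as a port.
  let Λ : Bool → Finset V := fun i => N.filter fun w =>
    G.Adj w (cond i v₁ v₂) ∧ (G.Adj w (cond i v₃ v₅) ∨ G.Adj w v₄)
  have hside : ∀ v ∈ B, ∀ x ∈ B, Gᶜ.Adj x v →
      (U.filter fun u => ¬ G.Adj u v).card + (N.filter fun u => ¬ G.Adj u v).card + 2 ≤ t := by
    intro v hv x hx hxv
    -- The non-neighbours of `v` form a clique, so there are fewer than `t`. One of them is the hole
    -- vertex `x`; this accounts for the 2.
    let S := insert x ((A \ B).filter fun u => ¬ G.Adj u v)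
    have hS : ∀ y ∈ S, y ∈ A ∧ Gᶜ.Adj y v := by
      intro y hy
      rcases Finset.mem_insert.mp hy with rfl | hy
      · exact ⟨hBA hx, hxv⟩
      · obtain ⟨h1, h2⟩ := Finset.mem_filter.mp hy
        obtain ⟨h3, h4⟩ := Finset.mem_sdiff.mp h1
        exact ⟨h3, by rw [SimpleGraph.compl_adj]; exact ⟨fun h => h4 (h ▸ hv), h2⟩⟩
    have h1 := hω S (fun y hy => (hS y hy).1) (fun y hy z hz =>
      hα y (hS y hy).1 v (hBA hv) z (hS z hz).1 (hS y hy).2 (hS z hz).2.symm)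
    rw [Finset.card_insert_of_notMem (by
      intro h
      exact (Finset.mem_sdiff.mp (Finset.mem_filter.mp h).1).2 hx)] at h1
    have h2 : (U.filter fun u => ¬ G.Adj u v) ∪ (N.filter fun u => ¬ G.Adj u v) ⊆
        (A \ B).filter fun u => ¬ G.Adj u v :=
      Finset.union_subset (Finset.filter_subset_filter _ hUAB)
        (Finset.filter_subset_filter _ hNAB)
    have h3 := Finset.card_le_card h2
    rw [Finset.card_union_of_disjoint] at h3
    · omega
    · exact (Finset.disjoint_sdiff (s := U) (t := A \ B)).mono (Finset.filter_subset _ _)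
        (Finset.filter_subset _ _)
  have hΛ : ∀ i, (E i).card ≤ (Λ i).card := by
    have hcount : ∀ x y z : V, ((A \ B).filter fun w => ¬ G.Adj w y ∧ ¬ G.Adj w z).card
        + 2 * t + 1 ≤ A.card →
        (U.filter fun u => ¬ G.Adj u x).card + (N.filter fun u => ¬ G.Adj u x).card + 2 ≤ t →
        (U.filter fun u => ¬ G.Adj u x).card ≤
          (N.filter fun w => G.Adj w x ∧ (G.Adj w y ∨ G.Adj w z)).card := by
      intro x y z h1 h2
      have h3 : N ⊆ (N.filter fun w => G.Adj w x ∧ (G.Adj w y ∨ G.Adj w z)) ∪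
          ((N.filter fun u => ¬ G.Adj u x) ∪
            ((A \ B).filter fun w => ¬ G.Adj w y ∧ ¬ G.Adj w z)) := by
        intro w hw
        have := hNAB hw
        simp only [Finset.mem_union, Finset.mem_filter, hw, this, true_and]
        tauto
      have h4 := Finset.card_le_card h3
      have h5 := h4.trans (Finset.card_union_le _ _)
      have h6 := Finset.card_union_le (N.filter fun u => ¬ G.Adj u x)
            ((A \ B).filter fun w => ¬ G.Adj w y ∧ ¬ G.Adj w z)
      omega
    intro i
    cases i
    · refine hcount v₂ v₅ v₄ ?_ (hside v₂ m2 v₄ m4 c24.symm)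
      simpa only [and_comm] using hK₂
    · exact hcount v₁ v₃ v₄ hK₁ (hside v₁ m1 v₃ m3 c13.symm)
  have hΛ' : (E true).card + (E false).card ≤ (Λ true ∪ Λ false).card := by
    rw [← Finset.card_union_add_card_inter]
    have h1 : E true ∪ E false ⊆ U :=
      Finset.union_subset (Finset.filter_subset _ _) (Finset.filter_subset _ _)
    have h2 := Finset.card_le_card h1
    let M := N.filter fun w => ¬ G.Adj w v₁ ∧ ¬ G.Adj w v₂
    -- A vertex adjacent to `v₁` but to neither `v₃` nor `v₄` sees `v₂` and `v₅`. A vertex adjacent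
    -- to `v₂` but not to `v₁` sees `v₄`.
    have h3 : N ⊆ (Λ true ∪ Λ false) ∪ M := by
      intro w hw
      have e13 := hmiss w (hNAB hw) _ m3 _ m5 c35
      have e24 := hmiss w (hNAB hw) _ m2 _ m4 c24
      have e41 := hmiss w (hNAB hw) _ m4 _ m1 c41
      simp only [Λ, M, Finset.mem_union, Finset.mem_filter, hw, true_and, cond_true, cond_false]
      tauto
    have h4 := (Finset.card_le_card h3).trans (Finset.card_union_le _ _)
    have h5 : (E true ∩ E false) ∪ M ⊆
        (A \ B).filter fun w => ¬ G.Adj w v₁ ∧ ¬ G.Adj w v₂ := by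
      intro w hw
      rcases Finset.mem_union.mp hw with hw | hw
      · obtain ⟨h6, h7⟩ := Finset.mem_inter.mp hw
        exact Finset.mem_filter.mpr ⟨hUAB (Finset.mem_filter.mp h6).1,
          (Finset.mem_filter.mp h6).2, (Finset.mem_filter.mp h7).2⟩
      · exact Finset.mem_filter.mpr ⟨hNAB (Finset.mem_filter.mp hw).1,
          (Finset.mem_filter.mp hw).2⟩
    have h6 := Finset.card_le_card h5
    rw [Finset.card_union_of_disjoint] at h6
    · omega
    · refine (Finset.disjoint_sdiff (s := U) (t := A \ B)).mono ?_ (Finset.filter_subset _ _)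
      exact Finset.inter_subset_left.trans (Finset.filter_subset _ _)
  obtain ⟨g, hg, hginj⟩ := exists_injective_assignment E Λ hΛ hΛ'
  have hports : ∀ u, ∃ d : Bool → V, u ∈ U →
      (∀ i, d i ∈ B ∧ G.Adj u (d i) ∧ (u ∉ E i → d i = cond i v₁ v₂) ∧
        (u ∈ E i → G.Adj (g i u) (d i))) ∧ d true ≠ d false := by
    intro u
    by_cases hu : u ∈ U
    swap
    · exact ⟨fun _ => v₁, fun h => absurd h hu⟩
    suffices h : ∃ x y, (x ∈ B ∧ G.Adj u x ∧ (u ∉ E true → x = v₁) ∧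
        (u ∈ E true → G.Adj (g true u) x)) ∧ (y ∈ B ∧ G.Adj u y ∧ (u ∉ E false → y = v₂) ∧
        (u ∈ E false → G.Adj (g false u) y)) ∧ x ≠ y by
      obtain ⟨x, y, h1, h2, h3⟩ := h
      refine ⟨fun i => cond i x y, fun _ => ⟨fun i => ?_, h3⟩⟩
      cases i
      · exact h2
      · exact h1
    have hE1 : u ∉ E true ↔ G.Adj u v₁ := by simp [E, hu]
    have hE2 : u ∉ E false ↔ G.Adj u v₂ := by simp [E, hu]
    have hu13 := hmiss u (hUAB hu) _ m1 _ m3 c13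
    have hu14 := hmiss u (hUAB hu) _ m4 _ m1 c41
    have hu24 := hmiss u (hUAB hu) _ m2 _ m4 c24
    have hu25 := hmiss u (hUAB hu) _ m5 _ m2 c52
    have hg1 : u ∈ E true → g true u ∈ A \ B ∧ (G.Adj (g true u) v₃ ∨ G.Adj (g true u) v₄) :=
      fun h => by
        obtain ⟨h1, -, h2⟩ := Finset.mem_filter.mp (hg true u h)
        exact ⟨hNAB h1, h2⟩
    have hg2 : u ∈ E false → G.Adj (g false u) v₅ ∨ G.Adj (g false u) v₄ :=
      fun h => (Finset.mem_filter.mp (hg false u h)).2.2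
    by_cases h1 : u ∈ E true
    · have h1' : ¬ G.Adj u v₁ := fun h => hE1.mpr h h1
      have hu3 : G.Adj u v₃ := hu13.resolve_left h1'
      have hu4 : G.Adj u v₄ := hu14.resolve_right h1'
      by_cases h2 : u ∈ E false
      · have h2' : ¬ G.Adj u v₂ := fun h => hE2.mpr h h2
        have hu5 : G.Adj u v₅ := hu25.resolve_right h2'
        by_cases hw3 : G.Adj (g true u) v₃
        · rcases hg2 h2 with hw | hw
          · exact ⟨v₃, v₅, ⟨m3, hu3, fun h => absurd h1 h, fun _ => hw3⟩,
              ⟨m5, hu5, fun h => absurd h2 h, fun _ => hw⟩, c35.ne⟩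
          · exact ⟨v₃, v₄, ⟨m3, hu3, fun h => absurd h1 h, fun _ => hw3⟩,
              ⟨m4, hu4, fun h => absurd h2 h, fun _ => hw⟩, a34.ne⟩
        -- A helper for `v₁` that misses `v₃` sees both `v₄` and `v₅`, so one of these remains
        -- whichever port serves `v₂`.
        · have hw4 := (hg1 h1).2.resolve_left hw3
          have hw5 := (hmiss _ (hg1 h1).1 _ m3 _ m5 c35).resolve_left hw3
          rcases hg2 h2 with hw | hw
          · exact ⟨v₄, v₅, ⟨m4, hu4, fun h => absurd h1 h, fun _ => hw4⟩,
              ⟨m5, hu5, fun h => absurd h2 h, fun _ => hw⟩, a45.ne⟩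
          · exact ⟨v₅, v₄, ⟨m5, hu5, fun h => absurd h1 h, fun _ => hw5⟩,
              ⟨m4, hu4, fun h => absurd h2 h, fun _ => hw⟩, a45.ne'⟩
      · have hu2 := hE2.mp h2
        rcases (hg1 h1).2 with hw | hw
        · exact ⟨v₃, v₂, ⟨m3, hu3, fun h => absurd h1 h, fun _ => hw⟩,
              ⟨m2, hu2, fun _ => rfl, fun h => absurd h h2⟩, a23.ne'⟩
        · exact ⟨v₄, v₂, ⟨m4, hu4, fun h => absurd h1 h, fun _ => hw⟩,
              ⟨m2, hu2, fun _ => rfl, fun h => absurd h h2⟩, c24.ne'⟩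
    · have hu1 := hE1.mp h1
      by_cases h2 : u ∈ E false
      · have h2' : ¬ G.Adj u v₂ := fun h => hE2.mpr h h2
        have hu5 : G.Adj u v₅ := hu25.resolve_right h2'
        have hu4 : G.Adj u v₄ := hu24.resolve_left h2'
        rcases hg2 h2 with hw | hw
        · exact ⟨v₁, v₅, ⟨m1, hu1, fun _ => rfl, fun h => absurd h h1⟩,
              ⟨m5, hu5, fun h => absurd h2 h, fun _ => hw⟩, a51.ne'⟩
        · exact ⟨v₁, v₄, ⟨m1, hu1, fun _ => rfl, fun h => absurd h h1⟩,
              ⟨m4, hu4, fun h => absurd h2 h, fun _ => hw⟩, c41.ne'⟩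
      · exact ⟨v₁, v₂, ⟨m1, hu1, fun _ => rfl, fun h => absurd h h1⟩,
              ⟨m2, hE2.mp h2, fun _ => rfl, fun h => absurd h h2⟩, a12.ne⟩
  choose d hd using hports
  have himg : Finset.univ.image (fun i : Bool => cond i v₁ v₂) = {v₁, v₂} := by
    ext x
    simp [eq_comm]
  rw [← himg]
  refine hU.union_of_ports hBA (fun i => cond i v₁ v₂) (fun i u => d u i) g E ?_ ?_
    (fun i u hu => ((hd u hu).1 i).1) (fun i u hu => ((hd u hu).1 i).2.1) ?_
    (fun i u hu => ((hd u hu).1 i).2.2.1) ?_ hginj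
  · intro i
    cases i
    exacts [m2, m1]
  · intro i j hij
    cases i <;> cases j
    · exact absurd rfl hij
    · exact a12.symm
    · exact a12
    · exact absurd rfl hij
  · intro i j u hu hij
    cases i <;> cases j
    · exact absurd rfl hij
    · exact (hd u hu).2.symm
    · exact (hd u hu).2
    · exact absurd rfl hij
  · intro i u hu
    have h1 := Finset.mem_filter.mp (hg i u hu)
    exact ⟨h1.1, ((hd u (Finset.mem_filter.mp hu).1).1 i).2.2.2 hu, h1.2.1⟩

/-! ### Independence number two -/

theorem exists_cliqueLinked_of_card_le {V : Type*} {G : SimpleGraph V} {A s : Finset V} {t : ℕ}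
    (hs : s ⊆ A) (hadj : ∀ x ∈ s, ∀ y ∈ s, ¬ Gᶜ.Adj x y) (ht : t ≤ s.card) :
    ∃ U : Finset V, U.card = t ∧ CliqueLinked G A U := by
  obtain ⟨U, hUs, hU⟩ := Finset.exists_subset_card_eq ht
  refine ⟨U, hU, CliqueLinked.of_pairwise_adj (hUs.trans hs) fun u hu v hv huv => ?_⟩
  have := hadj u (hUs hu) v (hUs hv)
  rw [SimpleGraph.compl_adj] at this
  by_contra h
  exact this ⟨huv, h⟩

/-- A closed walk of length five in the complement. -/
def HasComplFiveCycle {V : Type*} (G : SimpleGraph V) (A : Finset V) : Prop :=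
  ∃ a ∈ A, ∃ b ∈ A, ∃ c ∈ A, ∃ d ∈ A, ∃ e ∈ A,
    Gᶜ.Adj a b ∧ Gᶜ.Adj b c ∧ Gᶜ.Adj c d ∧ Gᶜ.Adj d e ∧ Gᶜ.Adj e a

open Classical in
-- Otherwise split the common neighbours `Z` of `x` and `y` into `Zx`, `Zy` and `Z₀`, by where they
-- have complement neighbours. Without a complement 5-cycle, `Q y ∪ Zx` and `Q x ∪ Zy` are cliques;
-- `Z₀` forms a clique with `Q x`, and also with `Q y`. All these have fewer than `t` vertices,
-- while `Q x` and `Q y` together have at least `A.card + 2 - t`. Adding up forces `A.card` below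
-- 5t/2.
theorem hasComplFiveCycle_of_few_common_neighbors {V : Type*} {G : SimpleGraph V} {A : Finset V}
    {t : ℕ} (hα : NoIndepTriple G A)
    (hω : ∀ s ⊆ A, (∀ x ∈ s, ∀ y ∈ s, ¬ Gᶜ.Adj x y) → s.card + 1 ≤ t)
    (hcommon : ∀ x ∈ A, ∀ y ∈ A, Gᶜ.Adj x y →
      (A.filter fun w => ¬ Gᶜ.Adj w x ∧ ¬ Gᶜ.Adj w y).card + 2 ≤ t)
    (ht : 5 * t ≤ 2 * A.card) {x y : V} (hx : x ∈ A) (hy : y ∈ A) (hxy : Gᶜ.Adj x y) :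
    HasComplFiveCycle G A := by
  by_contra hno
  have hno5 : ∀ a ∈ A, ∀ b ∈ A, ∀ c ∈ A, ∀ d ∈ A, ∀ e ∈ A, Gᶜ.Adj a b → Gᶜ.Adj b c →
      Gᶜ.Adj c d → Gᶜ.Adj d e → ¬ Gᶜ.Adj e a :=
    fun a ha b hb c hc d hd e he h1 h2 h3 h4 h5 =>
      hno ⟨a, ha, b, hb, c, hc, d, hd, e, he, h1, h2, h3, h4, h5⟩
  let Q : V → Finset V := fun v => A.filter fun w => Gᶜ.Adj w v
  let Z : Finset V := A.filter fun w => ¬ Gᶜ.Adj w x ∧ ¬ Gᶜ.Adj w y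
  have hQ : ∀ v w, w ∈ Q v ↔ w ∈ A ∧ Gᶜ.Adj w v := fun v w => by simp [Q]
  have hZ : ∀ w, w ∈ Z ↔ w ∈ A ∧ ¬ Gᶜ.Adj w x ∧ ¬ Gᶜ.Adj w y := fun w => by simp [Z]
  have hQQ : ∀ v ∈ A, ∀ w ∈ A, Gᶜ.Adj v w → A.card + 2 ≤ (Q v).card + (Q w).card + t := by
    intro v hv w hw hvw
    have h1 := hcommon v hv w hw hvw
    have h2 : A ⊆ (Q v ∪ Q w) ∪ A.filter fun u => ¬ Gᶜ.Adj u v ∧ ¬ Gᶜ.Adj u w := by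
      intro u hu
      simp only [Q, Finset.mem_union, Finset.mem_filter, hu, true_and]
      tauto
    have h3 := (Finset.card_le_card h2).trans (Finset.card_union_le _ _)
    have h4 := Finset.card_union_le (Q v) (Q w)
    omega
  have hQdisj : ∀ v ∈ A, ∀ w ∈ A, Gᶜ.Adj v w → Disjoint (Q v) (Q w) := by
    intro v hv w hw hvw
    rw [Finset.disjoint_left]
    intro u hu hu'
    rw [hQ] at hu hu'
    exact hα u hu.1 v hv w hw hu.2 hvw hu'.2
  let Zx := Z.filter fun z => ∃ p ∈ Q x, Gᶜ.Adj z p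
  let Zy := Z.filter fun z => ∃ p ∈ Q y, Gᶜ.Adj z p
  let Z₀ := Z.filter fun z => (∀ p ∈ Q x, ¬ Gᶜ.Adj z p) ∧ ∀ p ∈ Q y, ¬ Gᶜ.Adj z p
  have hZcard : Z.card + 2 ≤ t := hcommon x hx y hy hxy
  have hcross : ∀ v w, v ∈ A → w ∈ A → Gᶜ.Adj v w → ∀ z ∈ Z, (∃ p ∈ Q v, Gᶜ.Adj z p) →
      ∀ q ∈ Q w, ¬ Gᶜ.Adj z q := by
    rintro v w hv hw hvw z hz ⟨p, hp, hzp⟩ q hq hzq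
    rw [hQ] at hp hq
    exact hno5 z ((hZ z).mp hz).1 p hp.1 v hv w hw q hq.1 hzp hp.2 hvw hq.2.symm hzq.symm
  have hcliq : ∀ v w, v ∈ A → w ∈ A → Gᶜ.Adj v w →
      ((Q w) ∪ Z.filter fun z => ∃ p ∈ Q v, Gᶜ.Adj z p).card + 1 ≤ t := by
    intro v w hv hw hvw
    refine hω _ ?_ ?_
    · intro u hu
      rcases Finset.mem_union.mp hu with hu | hu
      · exact ((hQ _ _).mp hu).1
      · exact ((hZ _).mp (Finset.mem_filter.mp hu).1).1
    · intro a ha b hb hab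
      rcases Finset.mem_union.mp ha with ha | ha <;> rcases Finset.mem_union.mp hb with hb | hb
      · rw [hQ] at ha hb
        exact hα a ha.1 b hb.1 w hw hab hb.2 ha.2
      · obtain ⟨hb1, hb2⟩ := Finset.mem_filter.mp hb
        exact hcross v w hv hw hvw b hb1 hb2 a ha hab.symm
      · obtain ⟨ha1, ha2⟩ := Finset.mem_filter.mp ha
        exact hcross v w hv hw hvw a ha1 ha2 b hb hab
      · obtain ⟨ha1, p, hp, hap⟩ := Finset.mem_filter.mp ha
        obtain ⟨hb1, q, hq, hbq⟩ := Finset.mem_filter.mp hb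
        rw [hQ] at hp hq
        exact hno5 a ((hZ a).mp ha1).1 p hp.1 v hv q hq.1 b ((hZ b).mp hb1).1 hap hp.2
          hq.2.symm hbq.symm hab.symm
  have hZ₀A : ∀ z ∈ Z₀, z ∈ A := fun z hz => ((hZ z).mp (Finset.mem_filter.mp hz).1).1
  have hQZ₀ : ∀ z ∈ Z₀, Q z ⊆ Z := by
    intro z hz p hp
    obtain ⟨h1, h2, h3⟩ := Finset.mem_filter.mp hz
    rw [hQ] at hp
    rw [hZ]
    refine ⟨hp.1, fun h => ?_, fun h => ?_⟩
    · exact h2 p ((hQ _ _).mpr ⟨hp.1, h⟩) hp.2.symm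
    · exact h3 p ((hQ _ _).mpr ⟨hp.1, h⟩) hp.2.symm
  -- For nonadjacent `z` and `z'` the disjoint sets `Q z` and `Q z'` would both fit into `Z`, which
  -- has at most `t - 2` vertices; together they are larger.
  have hZ₀ind : ∀ z ∈ Z₀, ∀ z' ∈ Z₀, ¬ Gᶜ.Adj z z' := by
    intro z hz z' hz' h
    have h1 := hQQ z (hZ₀A z hz) z' (hZ₀A z' hz') h
    have h2 := Finset.card_le_card (Finset.union_subset (hQZ₀ z hz) (hQZ₀ z' hz'))
    rw [Finset.card_union_of_disjoint (hQdisj z (hZ₀A z hz) z' (hZ₀A z' hz') h)] at h2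
    omega
  have hcliq₀ : ∀ v ∈ A, (∀ z ∈ Z₀, ∀ p ∈ Q v, ¬ Gᶜ.Adj z p) → (∀ z ∈ Z₀, z ∉ Q v) →
      Z₀.card + (Q v).card + 1 ≤ t := by
    intro v hv hzp hdis
    rw [← Finset.card_union_of_disjoint (Finset.disjoint_left.mpr hdis)]
    refine hω _ ?_ ?_
    · intro u hu
      rcases Finset.mem_union.mp hu with hu | hu
      · exact hZ₀A u hu
      · exact ((hQ _ _).mp hu).1
    · intro a ha b hb hab
      rcases Finset.mem_union.mp ha with ha | ha <;> rcases Finset.mem_union.mp hb with hb | hb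
      · exact hZ₀ind a ha b hb hab
      · exact hzp a ha b hb hab
      · exact hzp b hb a ha hab.symm
      · rw [hQ] at ha hb
        exact hα a ha.1 b hb.1 v hv hab hb.2 ha.2
  have h1 := hcliq₀ x hx (fun z hz => (Finset.mem_filter.mp hz).2.1) (fun z hz h =>
    ((hZ z).mp (Finset.mem_filter.mp hz).1).2.1 ((hQ _ _).mp h).2)
  have h2 := hcliq₀ y hy (fun z hz => (Finset.mem_filter.mp hz).2.2) (fun z hz h =>
    ((hZ z).mp (Finset.mem_filter.mp hz).1).2.2 ((hQ _ _).mp h).2)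
  have h3 := hcliq x y hx hy hxy
  have h4 := hcliq y x hy hx hxy.symm
  have h5 : A ⊆ ((Q y ∪ Zx) ∪ (Q x ∪ Zy)) ∪ Z₀ := by
    intro u hu
    by_cases e1 : Gᶜ.Adj u x
    · exact Finset.mem_union_left _ (Finset.mem_union_right _
        (Finset.mem_union_left _ ((hQ _ _).mpr ⟨hu, e1⟩)))
    by_cases e2 : Gᶜ.Adj u y
    · exact Finset.mem_union_left _ (Finset.mem_union_left _
        (Finset.mem_union_left _ ((hQ _ _).mpr ⟨hu, e2⟩)))
    have hZu : u ∈ Z := (hZ u).mpr ⟨hu, e1, e2⟩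
    by_cases e3 : ∃ p ∈ Q x, Gᶜ.Adj u p
    · exact Finset.mem_union_left _ (Finset.mem_union_left _
        (Finset.mem_union_right _ (Finset.mem_filter.mpr ⟨hZu, e3⟩)))
    by_cases e4 : ∃ p ∈ Q y, Gᶜ.Adj u p
    · exact Finset.mem_union_left _ (Finset.mem_union_right _
        (Finset.mem_union_right _ (Finset.mem_filter.mpr ⟨hZu, e4⟩)))
    push Not at e3 e4
    exact Finset.mem_union_right _ (Finset.mem_filter.mpr ⟨hZu, e3, e4⟩)
  have h6 := (Finset.card_le_card h5).trans (Finset.card_union_le _ _)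
  have h7 := Finset.card_union_le (Q y ∪ Zx) (Q x ∪ Zy)
  have h8 := hQQ x hx y hy hxy
  change (Q y ∪ Zx).card + 1 ≤ t at h3
  change (Q x ∪ Zy).card + 1 ≤ t at h4
  omega

/-- In a set without independent triples, a closed walk of length five in the complement traces
out a five-hole. -/
theorem exists_fiveHole {V : Type*} [DecidableEq V] {G : SimpleGraph V} {A : Finset V}
    (hα : NoIndepTriple G A) (h : HasComplFiveCycle G A) :
    ∃ B ⊆ A, B.card = 5 ∧ ∃ v₁ v₂ v₃ v₄ v₅, FiveHole G B v₁ v₂ v₃ v₄ v₅ := by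
  obtain ⟨a, ha, b, hb, c, hc, d, hd, e, he, hab, hbc, hcd, hde, hea⟩ := h
  have hdiag : ∀ p ∈ A, ∀ q ∈ A, ∀ r ∈ A, ∀ s ∈ A, ∀ u ∈ A, Gᶜ.Adj p q → Gᶜ.Adj q r →
      Gᶜ.Adj r s → Gᶜ.Adj s u → Gᶜ.Adj u p → G.Adj p r := by
    intro p hp q hq r hr s hs u hu h1 h2 h3 h4 h5
    -- If `p = r`, the rest of the closed walk is a triangle in the complement.
    have hne : p ≠ r := by
      rintro rfl
      exact hα p hp s hs u hu h3 h4 h5.symm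
    by_contra hn
    exact hα p hp q hq r hr h1 h2 ((SimpleGraph.compl_adj _ _ _).mpr ⟨hne, hn⟩)
  have hac := hdiag a ha b hb c hc d hd e he hab hbc hcd hde hea
  have hbd := hdiag b hb c hc d hd e he a ha hbc hcd hde hea hab
  have hce := hdiag c hc d hd e he a ha b hb hcd hde hea hab hbc
  have hda := hdiag d hd e he a ha b hb c hc hde hea hab hbc hcd
  have heb := hdiag e he a ha b hb c hc d hd hea hab hbc hcd hde
  -- The diagonals of the complement cycle, in cyclic order, are the edges of the hole.
  refine ⟨{a, b, c, d, e}, ?_, ?_, a, c, e, b, d, ?_⟩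
  · intro x hx
    simp only [Finset.mem_insert, Finset.mem_singleton] at hx
    rcases hx with rfl | rfl | rfl | rfl | rfl <;> assumption
  · rw [Finset.card_insert_of_notMem, Finset.card_insert_of_notMem,
      Finset.card_insert_of_notMem, Finset.card_insert_of_notMem, Finset.card_singleton]
    · simpa using hde.ne
    · simpa using ⟨hcd.ne, hce.ne⟩
    · simpa using ⟨hbc.ne, hbd.ne, heb.ne'⟩
    · simpa using ⟨hab.ne, hac.ne, hda.ne', hea.ne'⟩
  · exact ⟨by simp, ⟨hac, hce, heb, hbd, hda⟩, ⟨hea.symm, hbc.symm, hde.symm, hab.symm, hcd.symm⟩⟩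

open Classical in
/-- A clique immersion avoiding a five-hole extends to two vertices of the five-hole. -/
theorem FiveHole.exists_cliqueLinked {V : Type*} {G : SimpleGraph V} {A B U : Finset V}
    {v₁ v₂ v₃ v₄ v₅ : V} {t : ℕ} (hC : FiveHole G B v₁ v₂ v₃ v₄ v₅) (hBA : B ⊆ A)
    (hB5 : B.card = 5) (hα : NoIndepTriple G A)
    (hω : ∀ s ⊆ A, (∀ x ∈ s, ∀ y ∈ s, ¬ Gᶜ.Adj x y) → s.card + 1 ≤ t)
    (ht : 5 * t ≤ 2 * A.card) (hU : CliqueLinked G (A \ B) U) (hUt : U.card + 2 = t) :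
    ∃ U' : Finset V, U'.card = t ∧ CliqueLinked G A U' := by
  let k : V → V → ℕ := fun x y => ((A \ B).filter fun w => ¬ G.Adj w x ∧ ¬ G.Adj w y).card
  have hsum : ∀ x ∈ B, ∀ y ∈ B, ∀ z ∈ B, Gᶜ.Adj x z → k x y + k y z + 1 ≤ t := by
    intro x hx y hy z hz hxz
    have hdisj : Disjoint ((A \ B).filter fun w => ¬ G.Adj w x ∧ ¬ G.Adj w y)
        ((A \ B).filter fun w => ¬ G.Adj w y ∧ ¬ G.Adj w z) := by
      rw [Finset.disjoint_left]
      intro w hw hw'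
      obtain ⟨h1, h2, -⟩ := Finset.mem_filter.mp hw
      obtain ⟨-, -, h3⟩ := Finset.mem_filter.mp hw'
      obtain ⟨h4, h5⟩ := Finset.mem_sdiff.mp h1
      exact hα w h4 x (hBA hx) z (hBA hz)
        ((SimpleGraph.compl_adj _ _ _).mpr ⟨fun h => h5 (h ▸ hx), h2⟩) hxz
        ((SimpleGraph.compl_adj _ _ _).mpr ⟨fun h => h5 (h ▸ hz), h3⟩)
    change _ + _ + 1 ≤ t
    rw [← Finset.card_union_of_disjoint hdisj]
    have hmem : ∀ w ∈ ((A \ B).filter fun w => ¬ G.Adj w x ∧ ¬ G.Adj w y) ∪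
        ((A \ B).filter fun w => ¬ G.Adj w y ∧ ¬ G.Adj w z), w ∈ A ∧ Gᶜ.Adj w y := by
      intro w hw
      have h1 : w ∈ A \ B ∧ ¬ G.Adj w y := by
        rcases Finset.mem_union.mp hw with hw | hw
        · exact ⟨(Finset.mem_filter.mp hw).1, (Finset.mem_filter.mp hw).2.2⟩
        · exact ⟨(Finset.mem_filter.mp hw).1, (Finset.mem_filter.mp hw).2.1⟩
      obtain ⟨h4, h5⟩ := Finset.mem_sdiff.mp h1.1
      exact ⟨h4, (SimpleGraph.compl_adj _ _ _).mpr ⟨fun h => h5 (h ▸ hy), h1.2⟩⟩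
    exact hω _ (fun w hw => (hmem w hw).1) fun w hw w' hw' h =>
      hα w (hmem w hw).1 w' (hmem w' hw').1 y (hBA hy) h (hmem w' hw').2 (hmem w hw).2
  have hcard : ∀ x ∈ B, ∀ y ∈ B, x ≠ y → (U ∪ {x, y}).card = t := by
    intro x hx y hy hxy
    rw [Finset.card_union_of_disjoint, Finset.card_pair hxy, hUt]
    rw [Finset.disjoint_left]
    intro u hu hu'
    have := (Finset.mem_sdiff.mp (hU.1 hu)).2
    rcases Finset.mem_insert.mp hu' with rfl | h
    · exact this hx
    · exact this (Finset.mem_singleton.mp h ▸ hy)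
  obtain ⟨⟨m1, m2, m3, m4, m5⟩, ⟨a12, a23, a34, a45, a51⟩, ⟨c13, c24, c35, c41, c52⟩⟩ := id hC
  have s2 := hsum _ m1 _ m2 _ m3 c13
  have s3 := hsum _ m2 _ m3 _ m4 c24
  have s4 := hsum _ m3 _ m4 _ m5 c35
  have s5 := hsum _ m4 _ m5 _ m1 c41
  have s1 := hsum _ m5 _ m1 _ m2 c52
  -- Call a hole edge bad if its inequality fails, so that its `k` is at least `A.card - 2 * t`,
  -- hence at least t/2. Two incident edges are not both bad, since their values sum to less than
  -- `t`. So all bad edges lie among the two flanking some hole edge, and the ends of that middle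
  -- edge can be added.
  have hcases : ((k v₃ v₄ + 2 * t + 1 ≤ A.card ∧ k v₄ v₅ + 2 * t + 1 ≤ A.card ∧
        k v₁ v₂ + 2 * t + 1 ≤ A.card) ∨
      (k v₄ v₅ + 2 * t + 1 ≤ A.card ∧ k v₅ v₁ + 2 * t + 1 ≤ A.card ∧
        k v₂ v₃ + 2 * t + 1 ≤ A.card)) ∨
      (k v₅ v₁ + 2 * t + 1 ≤ A.card ∧ k v₁ v₂ + 2 * t + 1 ≤ A.card ∧
        k v₃ v₄ + 2 * t + 1 ≤ A.card) ∨
      (k v₁ v₂ + 2 * t + 1 ≤ A.card ∧ k v₂ v₃ + 2 * t + 1 ≤ A.card ∧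
        k v₄ v₅ + 2 * t + 1 ≤ A.card) ∨
      (k v₂ v₃ + 2 * t + 1 ≤ A.card ∧ k v₃ v₄ + 2 * t + 1 ≤ A.card ∧
        k v₅ v₁ + 2 * t + 1 ≤ A.card) := by
    omega
  rcases hcases with (⟨h1, h2, h3⟩ | ⟨h1, h2, h3⟩) | ⟨h1, h2, h3⟩ | ⟨h1, h2, h3⟩ | ⟨h1, h2, h3⟩
  · exact ⟨_, hcard _ m1 _ m2 a12.ne, hC.cliqueLinked_union hBA hB5 hα hω hU hUt h1 h2 h3⟩
  · exact ⟨_, hcard _ m2 _ m3 a23.ne,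
      hC.rotate.cliqueLinked_union hBA hB5 hα hω hU hUt h1 h2 h3⟩
  · exact ⟨_, hcard _ m3 _ m4 a34.ne,
      hC.rotate.rotate.cliqueLinked_union hBA hB5 hα hω hU hUt h1 h2 h3⟩
  · exact ⟨_, hcard _ m4 _ m5 a45.ne,
      hC.rotate.rotate.rotate.cliqueLinked_union hBA hB5 hα hω hU hUt h1 h2 h3⟩
  · exact ⟨_, hcard _ m5 _ m1 a51.ne,
      hC.rotate.rotate.rotate.rotate.cliqueLinked_union hBA hB5 hα hω hU hUt h1 h2 h3⟩

open Classical in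
/-- Graphs without independent triples on at least `5t/2` vertices immerse a clique on `t`
vertices. -/
theorem exists_cliqueLinked_of_noIndepTriple {V : Type*} [Fintype V] {G : SimpleGraph V} (t : ℕ)
    (A : Finset V) (hα : NoIndepTriple G A) (ht : 5 * t ≤ 2 * A.card) :
    ∃ U : Finset V, U.card = t ∧ CliqueLinked G A U := by
  induction t using Nat.strong_induction_on generalizing A with
  | _ t ih =>
  rcases Nat.eq_zero_or_pos t with rfl | htpos
  · exact ⟨∅, rfl, CliqueLinked.empty G A⟩
  by_contra hno
  have hαsub : ∀ A' ⊆ A, NoIndepTriple G A' := fun A' hA' x hx y hy z hz =>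
    hα x (hA' hx) y (hA' hy) z (hA' hz)
  have hω : ∀ s ⊆ A, (∀ x ∈ s, ∀ y ∈ s, ¬ Gᶜ.Adj x y) → s.card + 1 ≤ t := by
    intro s hs hadj
    by_contra hlt
    exact hno (exists_cliqueLinked_of_card_le hs hadj (by omega))
  obtain ⟨x, hx, y, hy, hxy⟩ : ∃ x ∈ A, ∃ y ∈ A, Gᶜ.Adj x y := by
    by_contra hcon
    push Not at hcon
    have := hω A subset_rfl hcon
    omega
  -- With `t - 1` common neighbours, the pair `x`, `y` dominates and the only cut to check is `{y}`,
  -- so a clique immersion of size `t - 1` would extend to `x`.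
  have hcommon : ∀ x ∈ A, ∀ y ∈ A, Gᶜ.Adj x y →
      (A.filter fun w => ¬ Gᶜ.Adj w x ∧ ¬ Gᶜ.Adj w y).card + 2 ≤ t := by
    intro x hx y hy hxy
    by_contra hlt
    have hIA : ({x, y} : Finset V) ⊆ A := by
      intro z hz
      rcases Finset.mem_insert.mp hz with rfl | hz
      · exact hx
      · exact Finset.mem_singleton.mp hz ▸ hy
    have hcI : (A \ {x, y}).card + 2 = A.card := by
      have := Finset.card_sdiff_add_card_eq_card hIA
      rwa [Finset.card_pair hxy.ne] at this
    obtain ⟨U, hUt, hU⟩ := ih (t - 1) (by omega) (A \ {x, y}) (hαsub _ Finset.sdiff_subset)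
      (by omega)
    have hxU : x ∉ U := fun h => (Finset.mem_sdiff.mp (hU.1 h)).2 (by simp)
    refine hno ⟨U ∪ {x}, ?_, hU.union_singleton_of_crossing hIA (by simp) ?_ ?_⟩
    · rw [Finset.card_union_of_disjoint (by simpa using hxU), Finset.card_singleton]
      omega
    · intro u hu
      obtain ⟨huA, huI⟩ := Finset.mem_sdiff.mp (hU.1 hu)
      simp only [Finset.mem_insert, Finset.mem_singleton, not_or] at huI
      by_contra hm
      refine hα u huA x hx y hy ?_ hxy ?_ <;> rw [SimpleGraph.compl_adj]
      · exact ⟨huI.1, fun h => hm ⟨x, by simp, h⟩⟩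
      · exact ⟨huI.2, fun h => hm ⟨y, by simp, h⟩⟩
    · intro Y hY hYne hxY
      have hYy : Y = {y} := by
        refine Finset.eq_singleton_iff_nonempty_unique_mem.mpr ⟨hYne, fun z hz => ?_⟩
        rcases Finset.mem_insert.mp (hY hz) with rfl | h
        · exact absurd hz hxY
        · exact Finset.mem_singleton.mp h
      have hsub : (A.filter fun w => ¬ Gᶜ.Adj w x ∧ ¬ Gᶜ.Adj w y) ⊆
          (A \ {x, y}).filter fun w => Meets G w Y ∧ Meets G w ({x, y} \ Y) := by
        intro w hw
        obtain ⟨hwA, h1, h2⟩ := Finset.mem_filter.mp hw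
        have hwx : w ≠ x := fun h => h2 (h ▸ hxy)
        have hwy : w ≠ y := fun h => h1 (h ▸ hxy.symm)
        rw [SimpleGraph.compl_adj, not_and, not_not] at h1 h2
        refine Finset.mem_filter.mpr ⟨by simp [hwA, hwx, hwy], ⟨y, by simp [hYy], h2 hwy⟩,
          ⟨x, by simp [hYy, hxy.ne], h1 hwx⟩⟩
      have := Finset.card_le_card hsub
      omega
  have ht2 := hcommon x hx y hy hxy
  obtain ⟨B, hBA, hB5, v₁, v₂, v₃, v₄, v₅, hC⟩ := exists_fiveHole hα
    (hasComplFiveCycle_of_few_common_neighbors hα hω hcommon ht hx hy hxy)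
  have hcB := Finset.card_sdiff_add_card_eq_card hBA
  obtain ⟨U, hUt, hU⟩ := ih (t - 2) (by omega) (A \ B) (hαsub _ Finset.sdiff_subset) (by omega)
  exact hno (hC.exists_cliqueLinked hBA hB5 hα hω ht hU (by omega))

/-! ### Arbitrary independence number -/

/-- A graph with independence number at most `a` immerses a clique on `t` vertices as soon as it
has at least `cliqueFactor a * t / 2` vertices. -/
def cliqueFactor (a : ℕ) : ℕ :=
  if a ≤ 1 then 2 else 4 * a - 3

/-- The extra 2 pays for the crossing vertices in the Menger step. The inequality is sharp when
exactly one of the two numbers is 1 and fails when both are, so independence number two needs its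
own argument. -/
theorem cliqueFactor_add_le {a b : ℕ} (ha : 1 ≤ a) (hb : 1 ≤ b) (hab : 3 ≤ a + b) :
    cliqueFactor a + cliqueFactor b + 2 ≤ cliqueFactor (a + b) := by
  unfold cliqueFactor
  split_ifs <;> omega

open Classical in
theorem exists_cliqueLinked_of_indep_card_le {V : Type*} [Fintype V] {G : SimpleGraph V} (a : ℕ)
    (ha : 1 ≤ a) (t : ℕ) (A : Finset V)
    (hα : ∀ s ⊆ A, (∀ x ∈ s, ∀ y ∈ s, ¬ G.Adj x y) → s.card ≤ a)
    (ht : cliqueFactor a * t ≤ 2 * A.card) :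
    ∃ U : Finset V, U.card = t ∧ CliqueLinked G A U := by
  induction a using Nat.strong_induction_on generalizing t A with
  | _ a iha =>
  obtain rfl | rfl | ha3 : a = 1 ∨ a = 2 ∨ 3 ≤ a := by omega
  · refine exists_cliqueLinked_of_card_le subset_rfl ?_
      (by simp only [cliqueFactor, le_refl, if_true] at ht; omega)
    intro x hx y hy hxy
    rw [SimpleGraph.compl_adj] at hxy
    have h1 := hα {x, y} (by
      intro z hz
      rcases Finset.mem_insert.mp hz with rfl | hz
      · exact hx
      · exact Finset.mem_singleton.mp hz ▸ hy) (by
      intro u hu v hv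
      simp only [Finset.mem_insert, Finset.mem_singleton] at hu hv
      have hyx := fun h => hxy.2 (G.adj_symm h)
      rcases hu with rfl | rfl <;> rcases hv with rfl | rfl <;>
        first | exact G.irrefl | exact hxy.2 | exact hyx)
    rw [Finset.card_pair hxy.1] at h1
    omega
  · refine exists_cliqueLinked_of_noIndepTriple t A ?_ (by simpa [cliqueFactor] using ht)
    intro x hx y hy z hz hxy hyz hxz
    have h1 := hα {x, y, z} (by
      intro w hw
      simp only [Finset.mem_insert, Finset.mem_singleton] at hw
      rcases hw with rfl | rfl | rfl <;> assumption) (by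
      rw [SimpleGraph.compl_adj] at hxy hyz hxz
      have e1 := fun h => hxy.2 (G.adj_symm h)
      have e2 := fun h => hyz.2 (G.adj_symm h)
      have e3 := fun h => hxz.2 (G.adj_symm h)
      intro u hu v hv
      simp only [Finset.mem_insert, Finset.mem_singleton] at hu hv
      rcases hu with rfl | rfl | rfl <;> rcases hv with rfl | rfl | rfl <;>
        first
        | exact G.irrefl
        | exact hxy.2
        | exact hyz.2
        | exact hxz.2
        | exact e1
        | exact e2
        | exact e3)
    rw [Finset.card_insert_of_notMem (by simp [hxy.ne, hxz.ne]), Finset.card_pair hyz.ne] at h1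
    omega
  induction t generalizing A with
  | zero => exact ⟨∅, rfl, CliqueLinked.empty G A⟩
  | succ t iht =>
  by_contra hno
  have hfac : cliqueFactor a = 4 * a - 3 := by
    unfold cliqueFactor
    rw [if_neg (by omega)]
  by_cases hI : ∃ I ⊆ A, (∀ x ∈ I, ∀ y ∈ I, ¬ G.Adj x y) ∧ I.card = a
  swap
  · refine hno (iha (a - 1) (by omega) (by omega) (t + 1) A (fun s hs hind => ?_) ?_)
    · have h1 := hα s hs hind
      have h2 : s.card ≠ a := fun h => hI ⟨s, hs, hind, h⟩
      omega
    · refine le_trans (Nat.mul_le_mul_right _ ?_) ht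
      unfold cliqueFactor
      split_ifs <;> omega
  obtain ⟨I, hIA, hind, hIa⟩ := hI
  have hcI := Finset.card_sdiff_add_card_eq_card hIA
  -- Deleting `I` costs 2a on the right-hand side and frees 4a − 3 on the left.
  obtain ⟨U, hUt, hU⟩ := iht (A \ I) (fun s hs => hα s (hs.trans Finset.sdiff_subset)) (by
    rw [Nat.mul_succ] at ht
    omega)
  obtain ⟨b, hb⟩ : I.Nonempty := Finset.card_pos.mp (by omega)
  have hbU : b ∉ U := fun h => (Finset.mem_sdiff.mp (hU.1 h)).2 hb
  refine hno ⟨U ∪ {b}, ?_, hU.union_singleton_of_crossing hIA hb ?_ ?_⟩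
  · rw [Finset.card_union_of_disjoint (by simpa using hbU), Finset.card_singleton, hUt]
  · intro u hu
    obtain ⟨huA, huI⟩ := Finset.mem_sdiff.mp (hU.1 hu)
    by_contra hm
    have hm' : ∀ x ∈ I, ¬ G.Adj u x := fun x hx h => hm ⟨x, hx, h⟩
    have h1 := hα (insert u I) (Finset.insert_subset huA hIA) (by
      intro x hx y hy
      rcases Finset.mem_insert.mp hx with hxu | hxI <;>
        rcases Finset.mem_insert.mp hy with hyu | hyI
      · rw [hxu, hyu]
        exact G.irrefl
      · exact hxu ▸ hm' y hyI
      · exact fun h => hm' x hxI (hyu ▸ h.symm)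
      · exact hind x hxI y hyI)
    rw [Finset.card_insert_of_notMem huI] at h1
    omega
  · intro Y hYI hYne hbY
    -- An independent set with no neighbour in `X` can be enlarged by `X`, so these vertices have
    -- independence number at most `a - X.card`. By induction, many of them would already give the
    -- clique immersion.
    have hpart : ∀ X ⊆ I, X.Nonempty → X ≠ I →
        2 * ((A \ X).filter fun w => ¬ Meets G w X).card + 1 ≤
          cliqueFactor (a - X.card) * (t + 1) := by
      intro X hX hXne hXI
      have hXc : X.card < a := hIa ▸ Finset.card_lt_card (hX.ssubset_of_ne hXI)
      have hXpos := Finset.card_pos.mpr hXne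
      by_contra hlt
      obtain ⟨U', hU't, hU'⟩ := iha (a - X.card) (by omega) (by omega) (t + 1)
        ((A \ X).filter fun w => ¬ Meets G w X) (by
          intro s hs hsind
          have hs' : ∀ w ∈ s, (w ∈ A ∧ w ∉ X) ∧ ∀ x ∈ X, ¬ G.Adj w x := by
            intro w hw
            obtain ⟨h1, h2⟩ := Finset.mem_filter.mp (hs hw)
            exact ⟨Finset.mem_sdiff.mp h1, fun x hx h => h2 ⟨x, hx, h⟩⟩
          have h1 := hα (s ∪ X) (Finset.union_subset (fun w hw => (hs' w hw).1.1)
            (hX.trans hIA)) (by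
              intro x hx y hy
              rcases Finset.mem_union.mp hx with hx | hx <;>
                rcases Finset.mem_union.mp hy with hy | hy
              · exact hsind x hx y hy
              · exact (hs' x hx).2 y hy
              · exact fun h => (hs' y hy).2 x hx h.symm
              · exact hind x (hX hx) y (hX hy))
          rw [Finset.card_union_of_disjoint
            (Finset.disjoint_left.mpr fun w hw => (hs' w hw).1.2)] at h1
          omega) (by omega)
      exact hno ⟨U', hU't, hU'.mono
        ((Finset.filter_subset _ _).trans Finset.sdiff_subset) subset_rfl⟩
    have hYI' : Y ≠ I := fun h => hbY (h ▸ hb)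
    have hXne : (I \ Y).Nonempty := ⟨b, Finset.mem_sdiff.mpr ⟨hb, hbY⟩⟩
    have hcY := Finset.card_sdiff_add_card_eq_card hYI
    have hYpos := Finset.card_pos.mpr hYne
    have hXpos := Finset.card_pos.mpr hXne
    have h1 := hpart Y hYI hYne hYI'
    have h2 := hpart (I \ Y) Finset.sdiff_subset hXne (fun h => by rw [h] at hcY; omega)
    have e1 : a - Y.card = (I \ Y).card := by omega
    have e2 : a - (I \ Y).card = Y.card := by omega
    rw [e1] at h1
    rw [e2] at h2
    have h3 := cliqueFactor_add_le hXpos hYpos (by omega)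
    rw [hcY, hIa] at h3
    have h4 := Nat.mul_le_mul_right (t + 1) h3
    rw [add_mul, add_mul] at h4
    -- Vertices of `I` meet no part of `I`; each is placed with the part not containing it.
    have h5 : A ⊆ (((A \ Y).filter fun w => ¬ Meets G w Y) ∪
        ((A \ (I \ Y)).filter fun w => ¬ Meets G w (I \ Y))) ∪
        ((A \ I).filter fun w => Meets G w Y ∧ Meets G w (I \ Y)) := by
      intro w hw
      by_cases hwI : w ∈ I
      · have hnm : ∀ X ⊆ I, ¬ Meets G w X := fun X hX ⟨x, hx, h⟩ => hind w hwI x (hX hx) h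
        refine Finset.mem_union_left _ ?_
        by_cases hwY : w ∈ Y
        · exact Finset.mem_union_right _ (Finset.mem_filter.mpr
            ⟨by simp [hw, hwY], hnm _ Finset.sdiff_subset⟩)
        · exact Finset.mem_union_left _ (Finset.mem_filter.mpr
            ⟨by simp [hw, hwY], hnm _ hYI⟩)
      · have hwY : w ∉ Y := fun h => hwI (hYI h)
        by_cases m1 : Meets G w Y
        · by_cases m2 : Meets G w (I \ Y)
          · exact Finset.mem_union_right _ (Finset.mem_filter.mpr
              ⟨Finset.mem_sdiff.mpr ⟨hw, hwI⟩, m1, m2⟩)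
          · exact Finset.mem_union_left _ (Finset.mem_union_right _ (Finset.mem_filter.mpr
              ⟨by simp [hw, hwI], m2⟩))
        · exact Finset.mem_union_left _ (Finset.mem_union_left _ (Finset.mem_filter.mpr
            ⟨by simp [hw, hwY], m1⟩))
    have h6 := (Finset.card_le_card h5).trans (Finset.card_union_le _ _)
    have h7 := Finset.card_union_le ((A \ Y).filter fun w => ¬ Meets G w Y)
        ((A \ (I \ Y)).filter fun w => ¬ Meets G w (I \ Y))
    omega

/-! ### Immersions by paths, and the numerical bounds -/

theorem CliqueLinked.containsImmersion {V : Type*} {G : SimpleGraph V} {A U : Finset V}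
    (h : CliqueLinked G A U) : ContainsImmersion G (SimpleGraph.completeGraph (Fin U.card)) := by
  classical
  obtain ⟨-, F, h2, h3, h4⟩ := h
  let φ : Fin U.card ↪ V := U.equivFin.symm.toEmbedding.trans (Function.Embedding.subtype _)
  have hφ : ∀ i, φ i ∈ U := fun i => (U.equivFin.symm i).2
  have hpath : ∀ i j : Fin U.card, i ≠ j →
      ∃ p : G.Path (φ i) (φ j), ∀ f ∈ (p : G.Walk (φ i) (φ j)).edges, f ∈ F s(φ i, φ j) := by
    intro i j hij
    obtain ⟨q⟩ := h4 _ (hφ i) _ (hφ j) (fun h => hij (φ.injective h))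
    have hle : SimpleGraph.fromEdgeSet (F s(φ i, φ j)) ≤ G := by
      intro x y hxy
      rw [SimpleGraph.fromEdgeSet_adj] at hxy
      exact (h2 _ _ hxy.1).1
    refine ⟨(q.mapLe hle).toPath, fun f hf => ?_⟩
    have h5 := SimpleGraph.Walk.edges_toPath_subset_edges _ hf
    rw [SimpleGraph.Walk.edges_mapLe_eq_edges] at h5
    have h6 := q.edges_subset_edgeSet h5
    rw [SimpleGraph.edgeSet_fromEdgeSet] at h6
    exact h6.1
  choose p hp using hpath
  -- A path is chosen for increasing pairs only and reversed for the others, so that the two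
  -- orientations of an edge agree.
  refine ⟨φ, fun i j hij => if i < j then p i j hij.ne else (p j i hij.ne').reverse, ?_, ?_⟩
  · intro i j hij
    rcases lt_or_gt_of_ne hij.ne with hlt | hlt
    · simp [hlt, hlt.not_gt]
    · simp only [hlt, hlt.not_gt, if_true, if_false]
      exact Subtype.ext (by simp)
  · have hmem : ∀ (i j : Fin U.card) (hij : (SimpleGraph.completeGraph (Fin U.card)).Adj i j),
        ∀ f ∈ ((if i < j then p i j hij.ne else (p j i hij.ne').reverse : G.Path (φ i) (φ j)) :
          G.Walk (φ i) (φ j)).edges, f ∈ F s(φ i, φ j) := by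
      intro i j hij f hf
      split_ifs at hf with hlt
      · exact hp i j hij.ne f hf
      · rw [SimpleGraph.Path.reverse_coe, SimpleGraph.Walk.edges_reverse, List.mem_reverse] at hf
        rw [Sym2.eq_swap]
        exact hp j i hij.ne' f hf
    intro i j i' j' hij hij' hne f hf hf'
    refine Set.disjoint_left.mp (h3 s(φ i, φ j) s(φ i', φ j') ?_) (hmem i j hij f hf)
      (hmem i' j' hij' f hf')
    intro heq
    exact hne (Sym2.map.injective φ.injective heq)

theorem containsImmersion_completeGraph_of_le {V : Type*} [Fintype V] (G : SimpleGraph V)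
    (t : ℕ) (hα : 1 ≤ G.indepNum) (ht : cliqueFactor G.indepNum * t ≤ 2 * Fintype.card V) :
    ContainsImmersion G (SimpleGraph.completeGraph (Fin t)) := by
  obtain ⟨U, rfl, hU⟩ := exists_cliqueLinked_of_indep_card_le (G := G) G.indepNum hα t
    Finset.univ (fun s _ hs => SimpleGraph.IsIndepSet.card_le_indepNum
      (fun x hx y hy _ => hs x hx y hy)) (by simpa using ht)
  exact hU.containsImmersion

/-- Equivalently, 9α/4 − f(α) is at least 2α − 3/2, half the clique factor, with equality at α = 3.
For larger α the crude bound 1/12 on each summand suffices. -/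
theorem immersionF_le {α : ℕ} (hα : 3 ≤ α) : immersionF α ≤ (α : ℚ) / 4 + 3 / 2 := by
  have h3 : (3 : ℚ) ≤ α := by exact_mod_cast hα
  unfold immersionF
  split_ifs with h
  · linarith
  · have hsum : ∑ i ∈ Finset.Icc 6 (α + 1), 1 / (2 * (i : ℚ)) ≤
        (Finset.Icc 6 (α + 1)).card • (1 / 12 : ℚ) := by
      refine Finset.sum_le_card_nsmul _ _ _ fun i hi => ?_
      have h6 : (6 : ℚ) ≤ i := by exact_mod_cast (Finset.mem_Icc.mp hi).1
      exact one_div_le_one_div_of_le (by norm_num) (by linarith)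
    rw [Nat.card_Icc, nsmul_eq_mul] at hsum
    have hc : ((α + 1 + 1 - 6 : ℕ) : ℚ) = α - 4 := by
      rw [Nat.cast_sub (by omega)]
      push_cast
      ring
    rw [hc] at hsum
    have h5 : (5 : ℚ) ≤ α := by exact_mod_cast (by omega : 5 ≤ α)
    linarith

/-- The truncation at 0 is harmless, since the floor is nonnegative and so still bounds the
truncated value. -/
theorem mul_toNat_le_of_le {n g : ℕ} {c : ℚ} (hc : 0 < c) (hg : (g : ℚ) ≤ 2 * c) :
    g * (⌊(n : ℚ) / c⌋ - 1).toNat ≤ 2 * n := by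
  have h1 : (((⌊(n : ℚ) / c⌋ - 1).toNat : ℕ) : ℚ) ≤ (n : ℚ) / c := by
    have h2 : (0 : ℤ) ≤ ⌊(n : ℚ) / c⌋ := Int.floor_nonneg.mpr (by positivity)
    have h3 : ((⌊(n : ℚ) / c⌋ - 1).toNat : ℤ) ≤ ⌊(n : ℚ) / c⌋ := by omega
    calc (((⌊(n : ℚ) / c⌋ - 1).toNat : ℕ) : ℚ) ≤ ((⌊(n : ℚ) / c⌋ : ℤ) : ℚ) := by exact_mod_cast h3
      _ ≤ _ := Int.floor_le _
  rw [le_div_iff₀ hc] at h1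
  have h4 : (g : ℚ) * ((⌊(n : ℚ) / c⌋ - 1).toNat : ℕ) ≤
      2 * c * ((⌊(n : ℚ) / c⌋ - 1).toNat : ℕ) :=
    mul_le_mul_of_nonneg_right hg (Nat.cast_nonneg _)
  have h5 : (g : ℚ) * ((⌊(n : ℚ) / c⌋ - 1).toNat : ℕ) ≤ 2 * n := by linarith
  exact_mod_cast h5

theorem theorem1p3 {V : Type*} [Fintype V] (G : SimpleGraph V) (n α : ℕ)
    (hn : Fintype.card V = n) (hα : G.indepNum = α) :
    (3 ≤ α → ∃ m : ℕ, ⌊(n : ℚ) / (9 / 4 * (α : ℚ) - immersionF α)⌋ - 1 ≤ (m : ℤ) ∧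
      ContainsImmersion G (SimpleGraph.completeGraph (Fin m))) ∧
    (1 ≤ α → α ≤ 10 →
      ContainsImmersion G
        (SimpleGraph.completeGraph (Fin (⌊(n : ℚ) / (2 * (α : ℚ))⌋ - 1).toNat))) := by
  subst hn hα
  refine ⟨fun h3 => ⟨_, Int.self_le_toNat _, ?_⟩, fun h1 _ => ?_⟩
  · refine containsImmersion_completeGraph_of_le G _ (by omega) (mul_toNat_le_of_le ?_ ?_)
    all_goals
      have hf := immersionF_le h3
      have h3' : (3 : ℚ) ≤ G.indepNum := by exact_mod_cast h3
    · linarith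
    · rw [cliqueFactor, if_neg (by omega), Nat.cast_sub (by omega)]
      push_cast
      linarith
  · have h1' : (1 : ℚ) ≤ G.indepNum := by exact_mod_cast h1
    refine containsImmersion_completeGraph_of_le G _ h1 (mul_toNat_le_of_le (by positivity) ?_)
    rw [cliqueFactor]
    split_ifs
    · push_cast
      linarith
    · rw [Nat.cast_sub (by omega)]
      push_cast
      linarith
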